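/- **Theorem 3.1 (Lower complexity bound).** Let $M\ge 2$, $U\in(0,1)$, $\epsilon>0$, and let $\mathcal G$ be the path graph on the nodes $\{1,\dots,M\}$, with degrees $d_i$, degree matrix $P=\mathrm{diag}(d_1,\dots,d_M)$ and normalized Laplacian $\mathcal L$ ($\mathcal L_{ii}=1$, $\mathcal L_{ij}=-1/\sqrt{d_id_j}$ if $i\sim j$, and $0$ otherwise). Write $\underline{\lambda}_{\min}(\cdot)$ for the second smallest eigenvalue of a symmetric matrix and $\xi(\mathcal G)=\underline{\lambda}_{\min}(\mathcal L)/\lambda_{\max}(\mathcal L)$ for the spectral gap. *Problems.* $\mathcal P^M_U$ (in dimension $S$) consists of the families $f_1,\dots,f_M:\mathbb R^S\to\mathbb R$ of differentiable functions such that, for every $i$, the smallest Lipschitz constant of $\nabla f_i$ is $U$, and such that $f(x):=\frac1M\sum_{i=1}^M f_i(x_i)$, $x=(x_1,\dots,x_M)\in\mathbb R^{SM}$, is bounded below. Put $d_0=[\nabla f_1(0),\dots,\nabla f_M(0)]$ and $$\Delta(f):=f(0)-\inf_x f(x)+\frac{\|d_0\|^2}{MU}.$$ *Algorithms.* An algorithm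 in class $\mathcal A$ consists, for every dimension $S$, of linear operators on $\mathbb R^S$, fixed in advance: broadcast operators $Q_i^t$, and operators (blocks of the combination operator $W_i^t$) acting on the individual data listed below. At iteration $t+1$ ($t\ge 0$) node $i$ has the data $v_j^k=Q_j^k(x_j^k)$ for the neighbours $j\sim i$, $\nabla f_i(x_i^k)$ and $x_i^k$, for $0\le k\le t$, and $x_i^{t+1}$ is a linear combination, with arbitrary real (possibly adaptively chosen) coefficients, of the images of these data under the corresponding blocks. In class $\mathcal A'$ the individual messages $v^k_j$ are replaced by the sums $\sum_{j\sim i}v_j^k$. All algorithms start from $x_i^0=0$ for all $i$. *Accuracy.* $$h_t^*:=\min_{0\le s\le t}\left\{\Big\|\frac1M\sum_{i=1}^M\nabla f_i(x_i^s)\Big\|^2+\frac{U}{M\,\underline{\lambda}_{\min}(P^{1/2}\mathcal LP^{1/2})}\sum_{(i,j):\,i\sim j}\|x_i^s-x_j^s\|^2\right\},$$ each edge being counted once. *Claim.* For every algorithm in class $\mathcal A$ or $\mathcal A'$ and every $\Delta>0$ there are a dimension $S$ and a problem $(f_1,\dots,f_M)\in\mathcal P^M_U$ on $\mathbb R^S$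 with $\Delta(f)=\Delta$ such that, for every sequence of iterates that the algorithm can generate on this problem over $\mathcal G$ and every $t$, the accuracy $h^*_t<\epsilon$ can hold only if $$t\ \ge\ \frac{1}{3\sqrt{\xi(\mathcal G)}}\left\lfloor\frac{\big(f(0)-\inf_x f(x)+\frac{\|d_0\|^2}{MU}\big)\,U}{1650\,\pi^2}\,\epsilon^{-1}\right\rfloor .$$ -/

import Mathlib

namespace DistOpt

/-- The space of a local variable, `ℝ^S` with the Euclidean norm. -/
abbrev E (S : ℕ) : Type := EuclideanSpace ℝ (Fin S)

section Problems

/-- The separable objective `f(x) = (1/M) ∑ᵢ fᵢ(xᵢ)` of the stacked variable `x = (x₁, …, x_M)`. -/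
noncomputable def objective {M S : ℕ} (f : Fin M → E S → ℝ) (x : Fin M → E S) : ℝ :=
  (1 / (M : ℝ)) * ∑ i, f i (x i)

/-- `L` is the smallest nonnegative Lipschitz constant of the gradient of `g`. -/
def IsGradLipschitzConst {S : ℕ} (g : E S → ℝ) (L : ℝ) : Prop :=
  IsLeast {K : ℝ | 0 ≤ K ∧ ∀ x z : E S, ‖gradient g x - gradient g z‖ ≤ K * ‖x - z‖} L

/-- The class `𝒫^M_U`: `M` differentiable component functions whose gradients are Lipschitz with
smallest constants `L₁ = ⋯ = L_M = U`, and whose separable objective is bounded below. -/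
structure ProblemClass {M S : ℕ} (U : ℝ) (f : Fin M → E S → ℝ) : Prop where
  differentiable : ∀ i, Differentiable ℝ (f i)
  gradLipschitz : ∀ i, IsGradLipschitzConst (f i) U
  bddBelow : BddBelow (Set.range (objective f))

/-- The quantity `f(0) - inf f + ‖d₀‖² / (M U)`, with `d₀ = [∇f₁(0), …, ∇f_M(0)]`. -/
noncomputable def initialGap {M S : ℕ} (U : ℝ) (f : Fin M → E S → ℝ) : ℝ :=
  objective f 0 - (⨅ x, objective f x) + (∑ i, ‖gradient (f i) 0‖ ^ 2) / (M * U)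

end Problems

section Networks

/-- The normalized graph Laplacian `𝓛`: ones on the diagonal, `-1/√(dᵢ dⱼ)` at adjacent pairs,
zero elsewhere (for graphs without isolated vertices). -/
noncomputable def normLaplacian {M : ℕ} (G : SimpleGraph (Fin M)) [DecidableRel G.Adj] :
    Matrix (Fin M) (Fin M) ℝ :=
  Matrix.of fun i j =>
    if i = j then 1
    else if G.Adj i j then -(1 / √((G.degree i : ℝ) * (G.degree j : ℝ)))
    else 0

/-- The matrix `P^{1/2}`, where `P` is the diagonal matrix of the degrees. -/
noncomputable def sqrtDegree {M : ℕ} (G : SimpleGraph (Fin M)) [DecidableRel G.Adj] :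
    Matrix (Fin M) (Fin M) ℝ :=
  Matrix.diagonal fun i => √(G.degree i : ℝ)

theorem normLaplacian_isHermitian {M : ℕ} (G : SimpleGraph (Fin M)) [DecidableRel G.Adj] :
    (normLaplacian G).IsHermitian := by
  ext i j
  simp only [normLaplacian, Matrix.conjTranspose_apply, Matrix.of_apply, star_trivial,
    eq_comm (a := j) (b := i), G.adj_comm j i, mul_comm (G.degree j : ℝ)]

theorem scaledLaplacian_isHermitian {M : ℕ} (G : SimpleGraph (Fin M)) [DecidableRel G.Adj] :
    (sqrtDegree G * normLaplacian G * sqrtDegree G).IsHermitian := by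
  have h : (sqrtDegree G).IsHermitian := Matrix.isHermitian_diagonal _
  have h2 := Matrix.isHermitian_conjTranspose_mul_mul (sqrtDegree G) (normLaplacian_isHermitian G)
  rwa [h.eq] at h2

/-- The second smallest eigenvalue, counted with multiplicity, of a symmetric matrix
(`eigenvalues₀` lists the eigenvalues in decreasing order). -/
noncomputable def secondSmallestEigenvalue {M : ℕ} (hM : 2 ≤ M) {A : Matrix (Fin M) (Fin M) ℝ}
    (hA : A.IsHermitian) : ℝ :=
  hA.eigenvalues₀ ⟨M - 2, by rw [Fintype.card_fin]; omega⟩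

/-- The largest eigenvalue of a symmetric matrix. -/
noncomputable def largestEigenvalue {M : ℕ} (hM : 2 ≤ M) {A : Matrix (Fin M) (Fin M) ℝ}
    (hA : A.IsHermitian) : ℝ :=
  hA.eigenvalues₀ ⟨0, by rw [Fintype.card_fin]; omega⟩

/-- The spectral gap `ξ(G)`: second smallest over largest eigenvalue of `𝓛`. -/
noncomputable def spectralGap {M : ℕ} (hM : 2 ≤ M) (G : SimpleGraph (Fin M))
    [DecidableRel G.Adj] : ℝ :=
  secondSmallestEigenvalue hM (normLaplacian_isHermitian G) /
    largestEigenvalue hM (normLaplacian_isHermitian G)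

/-- Adjacency in a path graph is decidable. -/
instance pathGraphDecidableAdj (M : ℕ) : DecidableRel (SimpleGraph.pathGraph M).Adj :=
  fun _ _ => decidable_of_iff _ SimpleGraph.pathGraph_adj.symm

end Networks

section Accuracy

/-- The quantity `‖(1/M) ∑ᵢ ∇fᵢ(xᵢ)‖² + U / (M λ) · ∑_{i ∼ j} ‖xᵢ - xⱼ‖²` at local variables
`x₁, …, x_M`, where `λ` is the second smallest eigenvalue of `P^{1/2} 𝓛 P^{1/2}`
and every edge is counted once. -/
noncomputable def localError {M S : ℕ} (hM : 2 ≤ M) (G : SimpleGraph (Fin M))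
    [DecidableRel G.Adj] (U : ℝ) (f : Fin M → E S → ℝ) (x : Fin M → E S) : ℝ :=
  ‖(1 / (M : ℝ)) • ∑ i, gradient (f i) (x i)‖ ^ 2 +
    U / (M * secondSmallestEigenvalue hM (scaledLaplacian_isHermitian G)) *
      ∑ i, ∑ j with G.Adj i j ∧ i < j, ‖x i - x j‖ ^ 2

/-- The accuracy `h*_t` of a sequence of local variables: the best local error among
the iterates `0, …, t`. -/
noncomputable def hStar {M S : ℕ} (hM : 2 ≤ M) (G : SimpleGraph (Fin M))
    [DecidableRel G.Adj] (U : ℝ) (f : Fin M → E S → ℝ) (x : ℕ → Fin M → E S) (t : ℕ) : ℝ :=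
  (Finset.range (t + 1)).inf' Finset.nonempty_range_add_one
    fun s => localError hM G U f (x s)

end Accuracy

section Algorithms

/-- The linear operators on `ℝ^S`. -/
abbrev Op (S : ℕ) : Type := E S →ₗ[ℝ] E S

/-- A distributed first-order algorithm on `M` nodes, of class `𝒜` or of class `𝒜'`.
`Q S t i` is the operator through which node `i` broadcasts its iterate number `t` when
the variables live in `ℝ^S`. The linear operator which node `i` uses to form iterate `t + 1` is
given by its blocks: `Wg S t k i` acts on the gradient `∇fᵢ(xᵢᵏ)`, `Wx S t k i` on the node's own
iterate `xᵢᵏ`, and `Wv` on the messages of round `k`. In class `𝒜` there is one such block for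
every neighbour `j`, `Wv S t k i j`; in class `𝒜'` there is a single block `Wv S t k i`,
which acts on the sum of the messages of the neighbours. -/
inductive Algorithm (M : ℕ) : Type
  | classA (Q : (S : ℕ) → ℕ → Fin M → Op S)
      (Wv : (S : ℕ) → ℕ → ℕ → Fin M → Fin M → Op S)
      (Wg Wx : (S : ℕ) → ℕ → ℕ → Fin M → Op S) : Algorithm M
  | classAPrime (Q : (S : ℕ) → ℕ → Fin M → Op S)
      (Wv : (S : ℕ) → ℕ → ℕ → Fin M → Op S)
      (Wg Wx : (S : ℕ) → ℕ → ℕ → Fin M → Op S) : Algorithm M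

/-- The set in which `xᵢ^{t+1}` has to lie, given the history `x⁰, …, xᵗ`: all linear
combinations of the outputs of the blocks of the algorithm on the data available to node `i`.
(With all coefficients equal to one, this is the value of a fixed linear operator on
those data; with scalar multiples of the identity as blocks, it is the span of the data. The
coefficients may be chosen adaptively.) -/
noncomputable def Algorithm.admissible {M : ℕ} (alg : Algorithm M) (G : SimpleGraph (Fin M))
    [DecidableRel G.Adj] {S : ℕ} (f : Fin M → E S → ℝ) (x : ℕ → Fin M → E S) (t : ℕ)
    (i : Fin M) : Submodule ℝ (E S) :=
  match alg with
  | .classA Q Wv Wg Wx =>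
      Submodule.span ℝ
        ({w | ∃ k ≤ t, ∃ j, G.Adj i j ∧ w = Wv S t k i j (Q S k j (x k j))} ∪
          {w | ∃ k ≤ t, w = Wg S t k i (gradient (f i) (x k i))} ∪
          {w | ∃ k ≤ t, w = Wx S t k i (x k i)})
  | .classAPrime Q Wv Wg Wx =>
      Submodule.span ℝ
        ({w | ∃ k ≤ t, w = Wv S t k i (∑ j ∈ G.neighborFinset i, Q S k j (x k j))} ∪
          {w | ∃ k ≤ t, w = Wg S t k i (gradient (f i) (x k i))} ∪
          {w | ∃ k ≤ t, w = Wx S t k i (x k i)})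

/-- `x` is a sequence of iterates which the algorithm can generate on the problem `f` over the
network `G` when all local variables start from zero. -/
structure Algorithm.IsRun {M : ℕ} (alg : Algorithm M) (G : SimpleGraph (Fin M))
    [DecidableRel G.Adj] {S : ℕ} (f : Fin M → E S → ℝ) (x : ℕ → Fin M → E S) : Prop where
  zero : ∀ i, x 0 i = 0
  step : ∀ t i, x (t + 1) i ∈ alg.admissible G f x t i

end Algorithms

end DistOpt

/-! The hard problem splits a nonconvex zero-chain between the two ends of the path. In the chain
function a zero coordinate `k ≥ 1` can acquire a nonzero slope only when coordinate `k - 1` is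
positive, and while the last coordinate is zero some partial derivative stays bounded away from zero
(`exists_chainSlope_le`). Even links are held by the first third of the nodes and odd links by the
last third, so each new coordinate costs a trip across the middle third, about `M / 3` rounds
(`Algorithm.IsRun.mem_reach`). Since `1 / √ξ ≤ 2 * M` (`inv_le_sqrt_spectralGap_pathGraph`), this is
the required rate.

Arbitrary linear operators might produce a chain direction without any gradient revealing it. But
the operators are fixed in advance, and the number used in `T` rounds does not depend on the
dimension. In a large dimension the directions can be chosen one by one, each orthogonal to
everything those operators make of its predecessors (`exists_hidden_frame`). Working with spans
makes the adaptive coefficients irrelevant.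

While no local variable has a component along the last direction, neither has their mean, and the
averaged gradient at the mean is large. By the Lipschitz bound and the Poincaré inequality for the
path, the accuracy measure controls that gradient up to a factor two
(`norm_average_gradient_mean_sq_le`).

Each component also carries a quadratic in a separate direction `e`. It makes the smallest Lipschitz
constant exactly `U`, and its offset `a` raises the initial gap to exactly `Δ` without changing the
infimum. -/

namespace DistOpt

/-! ### One-dimensional building blocks of the chain. -/

section ScalarProfiles

/-- The function `max(x, 0)² / 2`, a primitive of `max(x, 0)`. -/
noncomputable def posSq (x : ℝ) : ℝ := max x 0 ^ 2 / 2

theorem hasDerivAt_posSq (x : ℝ) : HasDerivAt posSq (max x 0) x := by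
  rcases lt_trichotomy x 0 with hx | rfl | hx
  · rw [max_eq_right hx.le]
    refine (hasDerivAt_const x (0 : ℝ)).congr_of_eventuallyEq ?_
    filter_upwards [Iio_mem_nhds hx] with y hy
    simp [posSq, max_eq_right (Set.mem_Iio.1 hy).le]
  · rw [max_self, hasDerivAt_iff_isLittleO_nhds_zero]
    have h : (fun h : ℝ => posSq (0 + h) - posSq 0 - h • (0 : ℝ)) =O[nhds 0] fun h => h ^ 2 := by
      refine Asymptotics.IsBigO.of_bound 1 (Filter.Eventually.of_forall fun h => ?_)
      rcases le_total h 0 with h0 | h0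
      · simp [posSq, h0, sq_nonneg]
      · simp only [posSq, zero_add, max_self, max_eq_left h0, smul_zero, sub_zero, Real.norm_eq_abs]
        rw [show h ^ 2 / 2 - 0 ^ 2 / 2 = h ^ 2 / 2 by ring, abs_of_nonneg (by positivity),
          abs_of_nonneg (by positivity)]
        nlinarith [sq_nonneg h]
    exact h.trans_isLittleO (by simpa using Asymptotics.isLittleO_pow_id (𝕜 := ℝ) one_lt_two)
  · rw [max_eq_left hx.le]
    have h2 : HasDerivAt (fun y : ℝ => y ^ 2 / 2) x x := by
      simpa using (hasDerivAt_pow 2 x).div_const 2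
    refine h2.congr_of_eventuallyEq ?_
    filter_upwards [Ioi_mem_nhds hx] with y hy
    simp [posSq, max_eq_left (Set.mem_Ioi.1 hy).le]

theorem hasDerivAt_posSq_sub (c x : ℝ) :
    HasDerivAt (fun y => posSq (y - c)) (max (x - c) 0) x := by
  simpa using (hasDerivAt_posSq (x - c)).comp_sub_const x c

/-- A `C^{1,1}` step from `0` on `(-∞, 0]` to `1` on `[1, ∞)`. -/
noncomputable def step (x : ℝ) : ℝ := 4 * (posSq (x - 0) - 2 * posSq (x - 1 / 2) + posSq (x - 1))

/-- The derivative of `step`. -/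
noncomputable def step' (x : ℝ) : ℝ := 4 * (max (x - 0) 0 - 2 * max (x - 1 / 2) 0 + max (x - 1) 0)

/-- A bounded nondecreasing `C^{1,1}` function with slope one on `[0, 1]`. -/
noncomputable def ramp (x : ℝ) : ℝ :=
  posSq (x - -1) - posSq (x - 0) - posSq (x - 1) + posSq (x - 2)

/-- The derivative of `ramp`. -/
noncomputable def ramp' (x : ℝ) : ℝ :=
  max (x - -1) 0 - max (x - 0) 0 - max (x - 1) 0 + max (x - 2) 0

/-- The function `min(x, 0)² / 2`. -/
noncomputable def negSq (x : ℝ) : ℝ := posSq (-x)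

theorem hasDerivAt_step (x : ℝ) : HasDerivAt step (step' x) x :=
  (((hasDerivAt_posSq_sub 0 x).sub ((hasDerivAt_posSq_sub (1 / 2) x).const_mul 2)).add
    (hasDerivAt_posSq_sub 1 x)).const_mul 4

theorem hasDerivAt_ramp (x : ℝ) : HasDerivAt ramp (ramp' x) x :=
  (((hasDerivAt_posSq_sub (-1) x).sub (hasDerivAt_posSq_sub 0 x)).sub
    (hasDerivAt_posSq_sub 1 x)).add (hasDerivAt_posSq_sub 2 x)

theorem hasDerivAt_negSq (x : ℝ) : HasDerivAt negSq (-max (-x) 0) x := by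
  have h := (hasDerivAt_posSq (-x)).comp x (hasDerivAt_neg x)
  rw [mul_neg_one] at h
  exact h

theorem negSq_nonneg (x : ℝ) : 0 ≤ negSq x := by unfold negSq posSq; positivity

@[simp] theorem negSq_zero : negSq 0 = 0 := by simp [negSq, posSq]

theorem step_of_nonpos {x : ℝ} (hx : x ≤ 0) : step x = 0 := by
  simp [step, posSq, hx, show x ≤ 2⁻¹ by linarith, show x ≤ 1 by linarith]

theorem step_of_one_le {x : ℝ} (hx : 1 ≤ x) : step x = 1 := by
  rw [step, posSq, posSq, posSq, max_eq_left (by linarith), max_eq_left (by linarith),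
    max_eq_left (by linarith)]
  ring

theorem step'_of_nonpos {x : ℝ} (hx : x ≤ 0) : step' x = 0 := by
  simp [step', hx, show x ≤ 2⁻¹ by linarith, show x ≤ 1 by linarith]

theorem step'_nonneg (x : ℝ) : 0 ≤ step' x := by
  unfold step'; simp only [max_def]; split_ifs <;> linarith

theorem step'_le (x : ℝ) : step' x ≤ 2 := by
  unfold step'; simp only [max_def]; split_ifs <;> linarith

/-- Moving the knot to the right shortens the part of `[y, x]` on which the hinge increases. This
ordering lets the alternating hinge sums in `step'` and `ramp'` cancel, which gives better Lipschitz
constants than the triangle inequality. -/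
theorem max_sub_sub_max_sub_antitone {x y : ℝ} (h : y ≤ x) {a b : ℝ} (hab : a ≤ b) :
    max (x - b) 0 - max (y - b) 0 ≤ max (x - a) 0 - max (y - a) 0 := by
  simp only [max_def]; split_ifs <;> linarith

theorem max_sub_sub_max_sub_mem {x y : ℝ} (h : y ≤ x) (a : ℝ) :
    0 ≤ max (x - a) 0 - max (y - a) 0 ∧ max (x - a) 0 - max (y - a) 0 ≤ x - y := by
  simp only [max_def]; constructor <;> split_ifs <;> linarith

theorem step'_sub_le (x y : ℝ) : |step' x - step' y| ≤ 4 * |x - y| := by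
  wlog h : y ≤ x generalizing x y
  · rw [abs_sub_comm, abs_sub_comm x]
    exact this y x (le_of_not_ge h)
  have h1 := max_sub_sub_max_sub_antitone h (show (0 : ℝ) ≤ 1 / 2 by norm_num)
  have h2 := max_sub_sub_max_sub_antitone h (show (1 / 2 : ℝ) ≤ 1 by norm_num)
  have h3 := max_sub_sub_max_sub_mem h 0
  have h4 := max_sub_sub_max_sub_mem h (1 / 2)
  have h5 := max_sub_sub_max_sub_mem h 1
  rw [abs_of_nonneg (sub_nonneg.2 h), abs_le]
  unfold step'
  constructor <;> linarith [h3.1, h3.2, h4.1, h4.2, h5.1, h5.2]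

theorem ramp'_nonneg (x : ℝ) : 0 ≤ ramp' x := by
  unfold ramp'; simp only [max_def]; split_ifs <;> linarith

theorem ramp'_le (x : ℝ) : ramp' x ≤ 1 := by
  unfold ramp'; simp only [max_def]; split_ifs <;> linarith

theorem ramp'_sub_le (x y : ℝ) : |ramp' x - ramp' y| ≤ |x - y| := by
  wlog h : y ≤ x generalizing x y
  · rw [abs_sub_comm, abs_sub_comm x]
    exact this y x (le_of_not_ge h)
  have h1 := max_sub_sub_max_sub_antitone h (show (-1 : ℝ) ≤ 0 by norm_num)
  have h2 := max_sub_sub_max_sub_antitone h (show (1 : ℝ) ≤ 2 by norm_num)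
  have h3 := max_sub_sub_max_sub_mem h (-1)
  have h4 := max_sub_sub_max_sub_mem h 0
  have h5 := max_sub_sub_max_sub_mem h 1
  have h6 := max_sub_sub_max_sub_mem h 2
  rw [abs_of_nonneg (sub_nonneg.2 h), abs_le]
  unfold ramp'
  constructor <;> linarith [h3.1, h3.2, h4.1, h4.2, h5.1, h5.2, h6.1, h6.2]

/-- To the left of zero the barrier `negSq` gains at least the slope that `ramp` loses; hence a
negative coordinate cannot make the gradient of the chain small. -/
theorem one_le_ramp'_add {x : ℝ} (hx : x ≤ 1) : 1 ≤ ramp' x + max (-x) 0 := by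
  unfold ramp'; simp only [max_def]; split_ifs <;> linarith

theorem monotone_step : Monotone step :=
  monotone_of_deriv_nonneg (fun x => (hasDerivAt_step x).differentiableAt)
    fun x => (hasDerivAt_step x).deriv ▸ step'_nonneg x

theorem monotone_ramp : Monotone ramp :=
  monotone_of_deriv_nonneg (fun x => (hasDerivAt_ramp x).differentiableAt)
    fun x => (hasDerivAt_ramp x).deriv ▸ ramp'_nonneg x

theorem step_nonneg (x : ℝ) : 0 ≤ step x := by
  rcases le_total x 0 with h | h
  · exact (step_of_nonpos h).ge
  · simpa [step_of_nonpos le_rfl] using monotone_step h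

theorem step_le (x : ℝ) : step x ≤ 1 := by
  rcases le_total x 1 with h | h
  · simpa [step_of_one_le le_rfl] using monotone_step h
  · exact (step_of_one_le h).le

theorem ramp_of_le {x : ℝ} (hx : x ≤ -1) : ramp x = 0 := by
  rw [ramp, posSq, posSq, posSq, posSq, max_eq_right (by linarith), max_eq_right (by linarith),
    max_eq_right (by linarith), max_eq_right (by linarith)]
  ring

theorem ramp_of_two_le {x : ℝ} (hx : 2 ≤ x) : ramp x = 2 := by
  rw [ramp, posSq, posSq, posSq, posSq, max_eq_left (by linarith), max_eq_left (by linarith),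
    max_eq_left (by linarith), max_eq_left (by linarith)]
  ring

theorem ramp_nonneg (x : ℝ) : 0 ≤ ramp x := by
  rcases le_total x (-1) with h | h
  · exact (ramp_of_le h).ge
  · simpa [ramp_of_le le_rfl] using monotone_ramp h

theorem ramp_le (x : ℝ) : ramp x ≤ 2 := by
  rcases le_total x 2 with h | h
  · simpa [ramp_of_two_le le_rfl] using monotone_ramp h
  · exact (ramp_of_two_le h).le

theorem abs_sub_le_of_hasDerivAt {f f' : ℝ → ℝ} {C : ℝ} (hf : ∀ x, HasDerivAt f (f' x) x)
    (h0 : ∀ x, 0 ≤ f' x) (hC : ∀ x, f' x ≤ C) (x y : ℝ) : |f x - f y| ≤ C * |x - y| :=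
  Convex.norm_image_sub_le_of_norm_hasDerivWithin_le (s := Set.univ)
    (fun z _ => (hf z).hasDerivWithinAt)
    (fun z _ => by rw [Real.norm_eq_abs, abs_of_nonneg (h0 z)]; exact hC z)
    convex_univ (Set.mem_univ y) (Set.mem_univ x)

theorem step_sub_le (x y : ℝ) : |step x - step y| ≤ 2 * |x - y| :=
  abs_sub_le_of_hasDerivAt hasDerivAt_step step'_nonneg step'_le x y

theorem ramp_sub_le (x y : ℝ) : |ramp x - ramp y| ≤ |x - y| := by
  simpa using abs_sub_le_of_hasDerivAt hasDerivAt_ramp ramp'_nonneg ramp'_le x y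

end ScalarProfiles

/-! ### The zero-chain function and its gradient. -/

section Chain

/-- The factor by which coordinate `k - 1` activates coordinate `k` of the chain. -/
noncomputable def activation (y : ℕ → ℝ) : ℕ → ℝ
  | 0 => 1
  | k + 1 => step (y k)

/-- The chain function of the first `N` coordinates, link `k` carrying the weight `w k`. -/
noncomputable def chain (w : ℕ → ℝ) (N : ℕ) (y : ℕ → ℝ) : ℝ :=
  ∑ k ∈ Finset.range N, (negSq (y k) - w k * (activation y k * ramp (y k)))

/-- The partial derivative of the chain function in coordinate `k`. -/
noncomputable def chainSlope (w : ℕ → ℝ) (y : ℕ → ℝ) (k : ℕ) : ℝ :=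
  -max (-y k) 0 - w k * (activation y k * ramp' (y k)) -
    w (k + 1) * (step' (y k) * ramp (y (k + 1)))

theorem activation_nonneg (y : ℕ → ℝ) (k : ℕ) : 0 ≤ activation y k := by
  cases k with
  | zero => exact zero_le_one
  | succ k => exact step_nonneg _

theorem activation_le (y : ℕ → ℝ) (k : ℕ) : activation y k ≤ 1 := by
  cases k with
  | zero => exact le_rfl
  | succ k => exact step_le _

theorem chain_zero_le {w : ℕ → ℝ} (hw : ∀ k, 0 ≤ w k) (N : ℕ) : chain w N 0 ≤ 0 := by
  refine Finset.sum_nonpos fun k _ => ?_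
  have := mul_nonneg (hw k) (mul_nonneg (activation_nonneg 0 k) (ramp_nonneg ((0 : ℕ → ℝ) k)))
  simpa using this

theorem le_chain {w : ℕ → ℝ} (hw1 : ∀ k, w k ≤ 1) (N : ℕ) (y : ℕ → ℝ) :
    -(2 * N) ≤ chain w N y := by
  have h : ∀ k ∈ Finset.range N,
      (-2 : ℝ) ≤ negSq (y k) - w k * (activation y k * ramp (y k)) := by
    intro k _
    have h1 : activation y k * ramp (y k) ≤ 1 * 2 :=
      mul_le_mul (activation_le y k) (ramp_le _) (ramp_nonneg _) zero_le_one
    have h2 : w k * (activation y k * ramp (y k)) ≤ 1 * (1 * 2) :=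
      mul_le_mul (hw1 k) h1 (mul_nonneg (activation_nonneg y k) (ramp_nonneg _)) zero_le_one
    linarith [negSq_nonneg (y k)]
  have := Finset.card_nsmul_le_sum _ _ _ h
  simp only [Finset.card_range, nsmul_eq_mul] at this
  unfold chain
  linarith

theorem abs_chainSlope_zero_le {w : ℕ → ℝ} (hw : ∀ k, 0 ≤ w k) (hw1 : ∀ k, w k ≤ 1) (k : ℕ) :
    |chainSlope w 0 k| ≤ 1 := by
  have h1 : activation 0 k * ramp' 0 ≤ 1 * 1 :=
    mul_le_mul (activation_le 0 k) (ramp'_le _) (ramp'_nonneg _) zero_le_one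
  have h0 := mul_nonneg (activation_nonneg 0 k) (ramp'_nonneg 0)
  have h2 : w k * (activation 0 k * ramp' 0) ≤ 1 * (1 * 1) := mul_le_mul (hw1 k) h1 h0 zero_le_one
  have h3 := mul_nonneg (hw k) h0
  simp only [chainSlope, Pi.zero_apply, neg_zero, max_self, step'_of_nonpos le_rfl, zero_mul,
    mul_zero, sub_zero, zero_sub, abs_neg]
  rw [abs_of_nonneg h3]
  linarith

/-- The coupling to coordinate `k + 1` drops out because `step'` vanishes at zero, so only the
weighted activation can reveal coordinate `k`. -/
theorem chainSlope_eq_zero {w y : ℕ → ℝ} {k : ℕ} (hy : y k = 0)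
    (h : w k = 0 ∨ activation y k = 0) : chainSlope w y k = 0 := by
  rcases h with h | h <;> simp [chainSlope, hy, h, step'_of_nonpos le_rfl]

theorem abs_mul_sub_mul_le {a a' b b' A B δ η : ℝ} (ha : |a| ≤ A) (hb : |b'| ≤ B)
    (hδ : |a - a'| ≤ δ) (hη : |b - b'| ≤ η) : |a * b - a' * b'| ≤ A * η + B * δ := by
  have h : a * b - a' * b' = a * (b - b') + (a - a') * b' := by ring
  rw [h]
  refine (abs_add_le _ _).trans ?_
  rw [abs_mul, abs_mul, mul_comm B]
  gcongr
  · exact (abs_nonneg _).trans ha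
  · exact (abs_nonneg _).trans hδ

theorem activation_sub_le (y z : ℕ → ℝ) (k : ℕ) :
    |activation y k - activation z k| ≤ 2 * (if k = 0 then 0 else |y (k - 1) - z (k - 1)|) := by
  cases k with
  | zero => simp [activation]
  | succ k => simpa [activation] using step_sub_le (y k) (z k)

/-- Only neighbouring coordinates interact. The constant 10 is 1 from the barrier, 1 from `ramp'`,
and 8 from the 4-Lipschitz `step'` times `ramp ≤ 2`. -/
theorem abs_chainSlope_sub_le {w : ℕ → ℝ} (hw : ∀ k, 0 ≤ w k) (hw1 : ∀ k, w k ≤ 1)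
    (y z : ℕ → ℝ) (k : ℕ) :
    |chainSlope w y k - chainSlope w z k| ≤
      2 * (if k = 0 then 0 else |y (k - 1) - z (k - 1)|) + 10 * |y k - z k| +
        2 * |y (k + 1) - z (k + 1)| := by
  have h1 : |activation y k * ramp' (y k) - activation z k * ramp' (z k)| ≤
      1 * |y k - z k| + 1 * (2 * (if k = 0 then 0 else |y (k - 1) - z (k - 1)|)) :=
    abs_mul_sub_mul_le (by rw [abs_of_nonneg (activation_nonneg y k)]; exact activation_le y k)
      (by rw [abs_of_nonneg (ramp'_nonneg _)]; exact ramp'_le _) (activation_sub_le y z k)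
      (ramp'_sub_le _ _)
  have h2 : |step' (y k) * ramp (y (k + 1)) - step' (z k) * ramp (z (k + 1))| ≤
      2 * |y (k + 1) - z (k + 1)| + 2 * (4 * |y k - z k|) :=
    abs_mul_sub_mul_le (by rw [abs_of_nonneg (step'_nonneg _)]; exact step'_le _)
      (by rw [abs_of_nonneg (ramp_nonneg _)]; exact ramp_le _) (step'_sub_le _ _)
      (ramp_sub_le _ _)
  have h3 : |max (-y k) 0 - max (-z k) 0| ≤ |y k - z k| := by
    have := abs_max_sub_max_le_abs (-y k) (-z k) 0
    rwa [show -y k - -z k = -(y k - z k) by ring, abs_neg] at this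
  have hmul : ∀ {v a b : ℝ}, 0 ≤ v → v ≤ 1 → |a| ≤ b → |v * a| ≤ b := by
    intro v a b hv hv1 hab
    rw [abs_mul, abs_of_nonneg hv]
    nlinarith [abs_nonneg a]
  have h1' := abs_le.1 (hmul (hw k) (hw1 k) h1)
  have h2' := abs_le.1 (hmul (hw (k + 1)) (hw1 (k + 1)) h2)
  have h3' := abs_le.1 h3
  unfold chainSlope
  rw [abs_le]
  constructor <;> linarith [h1'.1, h1'.2, h2'.1, h2'.2, h3'.1, h3'.2]

/-- On sequences vanishing from index `N` on, the chain function has a `14`-Lipschitz gradient. -/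
theorem sum_chainSlope_sub_sq_le {w : ℕ → ℝ} (hw : ∀ k, 0 ≤ w k) (hw1 : ∀ k, w k ≤ 1) {N : ℕ}
    {y z : ℕ → ℝ} (hyz : y N = z N) :
    ∑ k ∈ Finset.range N, (chainSlope w y k - chainSlope w z k) ^ 2 ≤
      14 ^ 2 * ∑ k ∈ Finset.range N, (y k - z k) ^ 2 := by
  set d : ℕ → ℝ := fun k => |y k - z k| with hd
  set p : ℕ → ℝ := fun k => if k = 0 then 0 else d (k - 1) with hp
  -- Cauchy–Schwarz with weights 2, 10, 2, whose sum is 14; the three coefficients then add up to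
  -- 14².
  have h1 : ∀ k ∈ Finset.range N, (chainSlope w y k - chainSlope w z k) ^ 2 ≤
      28 * p k ^ 2 + 140 * d k ^ 2 + 28 * d (k + 1) ^ 2 := by
    intro k _
    have h := abs_chainSlope_sub_le hw hw1 y z k
    have h' : (chainSlope w y k - chainSlope w z k) ^ 2 ≤ (2 * p k + 10 * d k + 2 * d (k + 1)) ^ 2 := by
      rw [← sq_abs]
      exact pow_le_pow_left₀ (abs_nonneg _) h 2
    nlinarith [sq_nonneg (p k - d k), sq_nonneg (p k - d (k + 1)), sq_nonneg (d k - d (k + 1))]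
  refine (Finset.sum_le_sum h1).trans ?_
  have hs : ∑ k ∈ Finset.range N, d (k + 1) ^ 2 ≤ ∑ k ∈ Finset.range N, d k ^ 2 := by
    have e1 := Finset.sum_range_succ (fun k => d k ^ 2) N
    have e2 := Finset.sum_range_succ' (fun k => d k ^ 2) N
    have hN : d N = 0 := by simp [hd, hyz]
    rw [hN] at e1
    nlinarith [sq_nonneg (d 0)]
  have hpr : ∑ k ∈ Finset.range N, p k ^ 2 ≤ ∑ k ∈ Finset.range N, d k ^ 2 := by
    have e1 := Finset.sum_range_succ (fun k => p k ^ 2) N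
    have e2 := Finset.sum_range_succ' (fun k => p k ^ 2) N
    have e3 : ∀ k, p (k + 1) = d k := fun k => by simp [hp]
    simp only [e3] at e2
    have e4 : p 0 = 0 := by simp [hp]
    rw [e4] at e2
    nlinarith [sq_nonneg (p N)]
  have he : ∑ k ∈ Finset.range N, d k ^ 2 = ∑ k ∈ Finset.range N, (y k - z k) ^ 2 := by
    simp [hd, sq_abs]
  rw [Finset.sum_add_distrib, Finset.sum_add_distrib, ← Finset.mul_sum, ← Finset.mul_sum,
    ← Finset.mul_sum, ← he]
  linarith

/-- As long as the last coordinate of the chain has not been activated, the gradient of the chain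
function has an entry which is bounded away from zero. -/
theorem exists_chainSlope_le {w : ℕ → ℝ} {κ : ℝ} {N : ℕ} (hN : 0 < N) (hκ0 : 0 ≤ κ)
    (hκ : κ ≤ 1)
    (hw : ∀ k, 0 ≤ w k) (hκw : ∀ k < N, κ ≤ w k) {y : ℕ → ℝ} (hy : y (N - 1) = 0) :
    ∃ k < N, chainSlope w y k ≤ -κ := by
  classical
  -- The first coordinate below one is fully activated, since its predecessor, if any, is at least
  -- one. There barrier and ramp together contribute at most `-κ`, and the coupling to the next
  -- coordinate only lowers the slope further.
  have hex : ∃ k, y k < 1 := ⟨N - 1, by rw [hy]; exact zero_lt_one⟩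
  have hk := Nat.find_spec hex
  have hlt : Nat.find hex < N := by
    have := Nat.find_min' hex (m := N - 1) (by rw [hy]; exact zero_lt_one)
    omega
  have hact : activation y (Nat.find hex) = 1 := by
    cases h : Nat.find hex with
    | zero => rfl
    | succ m => exact step_of_one_le (not_lt.1 (Nat.find_min hex (m := m) (by omega)))
  refine ⟨_, hlt, ?_⟩
  unfold chainSlope
  rw [hact]
  have h1 := one_le_ramp'_add hk.le
  have h2 := hκw _ hlt
  have h3 := mul_nonneg (hw (Nat.find hex + 1)) (mul_nonneg (step'_nonneg (y (Nat.find hex)))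
    (ramp_nonneg (y (Nat.find hex + 1))))
  have h4 := ramp'_nonneg (y (Nat.find hex))
  have h5 : 0 ≤ max (-y (Nat.find hex)) 0 := le_max_right _ _
  nlinarith [mul_nonneg (sub_nonneg.2 h2) h4, mul_nonneg (sub_nonneg.2 hκ) h5,
    mul_nonneg hκ0 (sub_nonneg.2 h1)]

theorem hasFDerivAt_chain {F : Type*} [NormedAddCommGroup F] [NormedSpace ℝ F] {w : ℕ → ℝ} {N : ℕ}
    (hw : w N = 0) {y : F → ℕ → ℝ} {y' : ℕ → F →L[ℝ] ℝ} {x : F}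
    (hy : ∀ k, HasFDerivAt (fun x => y x k) (y' k) x) :
    HasFDerivAt (fun x => chain w N (y x))
      (∑ k ∈ Finset.range N, chainSlope w (y x) k • y' k) x := by
  have hstep : ∀ k, HasFDerivAt (fun x => step (y x k)) (step' (y x k) • y' k) x := fun k =>
    (hasDerivAt_step _).comp_hasFDerivAt x (hy k)
  have hramp : ∀ k, HasFDerivAt (fun x => ramp (y x k)) (ramp' (y x k) • y' k) x := fun k =>
    (hasDerivAt_ramp _).comp_hasFDerivAt x (hy k)
  have hneg : ∀ k, HasFDerivAt (fun x => negSq (y x k)) ((-max (-y x k) 0) • y' k) x := fun k =>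
    (hasDerivAt_negSq _).comp_hasFDerivAt x (hy k)
  -- `c k` is the part of the derivative of term `k` that acts through coordinate `k - 1`. It is
  -- moved to the preceding index; the boundary terms vanish because link 0 has constant activation
  -- and `w N = 0`.
  set c : ℕ → F →L[ℝ] ℝ := fun k =>
    if k = 0 then 0 else (w k * (step' (y x (k - 1)) * ramp (y x k))) • y' (k - 1) with hc
  have hterm : ∀ k ∈ Finset.range N,
      HasFDerivAt (fun x => negSq (y x k) - w k * (activation (y x) k * ramp (y x k)))
        ((-max (-y x k) 0 - w k * (activation (y x) k * ramp' (y x k))) • y' k - c k) x := by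
    intro k _
    have hact : HasFDerivAt (fun x => activation (y x) k)
        (if k = 0 then 0 else step' (y x (k - 1)) • y' (k - 1)) x := by
      cases k with
      | zero => simpa [activation] using hasFDerivAt_const (1 : ℝ) x
      | succ k => simpa [activation] using hstep k
    refine ((hneg k).sub ((hact.mul (hramp k)).const_mul (w k))).congr_fderiv ?_
    simp only [hc]
    split_ifs with h
    · module
    · module
  refine (HasFDerivAt.fun_sum hterm).congr_fderiv ?_
  have h1 : ∑ k ∈ Finset.range N, c k = ∑ k ∈ Finset.range N, c (k + 1) := by
    have e1 := Finset.sum_range_succ c N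
    have e2 := Finset.sum_range_succ' c N
    have e3 : c 0 = 0 := by simp [hc]
    have e4 : c N = 0 := by
      simp [hc, hw]
    rw [e1, e4, e3, add_zero, add_zero] at e2
    exact e2
  rw [Finset.sum_sub_distrib, h1, ← Finset.sum_sub_distrib]
  refine Finset.sum_congr rfl fun k _ => ?_
  simp only [hc, chainSlope, Nat.add_one_ne_zero, if_false, Nat.add_sub_cancel]
  module

end Chain

/-! ### Variational bounds for the extreme eigenvalues. -/

section Spectral

open Matrix

theorem quadForm_eq_sum_eigenvalues {M : ℕ} {A : Matrix (Fin M) (Fin M) ℝ} (hA : A.IsHermitian)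
    (x : EuclideanSpace ℝ (Fin M)) :
    x.ofLp ⬝ᵥ (A *ᵥ x.ofLp) = ∑ i, hA.eigenvalues i * inner ℝ (hA.eigenvectorBasis i) x ^ 2 := by
  set b := hA.eigenvectorBasis
  have h0 : ∀ y : EuclideanSpace ℝ (Fin M), x.ofLp ⬝ᵥ y.ofLp = inner ℝ x y := fun y => by
    simp [PiLp.inner_apply, dotProduct, mul_comm]
  have hsymm : ∀ i, inner ℝ (b i) (WithLp.toLp 2 (A *ᵥ x.ofLp)) =
      hA.eigenvalues i * inner ℝ (b i) x := by
    intro i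
    have h1 : inner ℝ (b i) (WithLp.toLp 2 (A *ᵥ x.ofLp)) = (b i).ofLp ⬝ᵥ (A *ᵥ x.ofLp) := by
      simp [PiLp.inner_apply, dotProduct, mul_comm]
    have hT : Aᵀ = A := by simpa [conjTranspose_eq_transpose_of_trivial] using hA.eq
    rw [h1, dotProduct_mulVec, ← mulVec_transpose, hT, hA.mulVec_eigenvectorBasis, smul_dotProduct]
    simp [PiLp.inner_apply, dotProduct, mul_comm, b]
  have := b.sum_inner_mul_inner x (WithLp.toLp 2 (A *ᵥ x.ofLp))
  rw [← h0] at this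
  rw [← this]
  refine Finset.sum_congr rfl fun i _ => ?_
  rw [hsymm, real_inner_comm]
  ring

/-- The index of the eigenvector which belongs to the second smallest eigenvalue. -/
theorem exists_eigenvalues_eq_second {M : ℕ} (hM : 2 ≤ M) {A : Matrix (Fin M) (Fin M) ℝ}
    (hA : A.IsHermitian) :
    ∃ i j : Fin M, i ≠ j ∧ hA.eigenvalues i = secondSmallestEigenvalue hM hA ∧
      hA.eigenvalues j ≤ secondSmallestEigenvalue hM hA ∧
      ∀ k, k ≠ j → secondSmallestEigenvalue hM hA ≤ hA.eigenvalues k := by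
  set e : Fin (Fintype.card (Fin M)) ≃ Fin M := Fintype.equivOfCardEq (Fintype.card_fin _) with he
  have hc : Fintype.card (Fin M) = M := Fintype.card_fin M
  have hev : ∀ k, hA.eigenvalues (e k) = hA.eigenvalues₀ k := fun k => by
    simp [Matrix.IsHermitian.eigenvalues, he]
  refine ⟨e ⟨M - 2, by omega⟩, e ⟨M - 1, by omega⟩, ?_, hev _, ?_, ?_⟩
  · intro h
    have := congrArg Fin.val (e.injective h)
    simp only at this
    omega
  · rw [hev]
    exact hA.eigenvalues₀_antitone (Fin.mk_le_mk.2 (by omega))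
  · intro k hk
    obtain ⟨k, rfl⟩ := e.surjective k
    rw [hev]
    refine hA.eigenvalues₀_antitone ?_
    have : k ≠ ⟨M - 1, by omega⟩ := fun h => hk (by rw [h])
    have hk' : (k : ℕ) ≠ M - 1 := fun h => this (Fin.ext h)
    have := k.2
    rw [Fin.le_def]
    simp only
    omega

theorem second_le_largestEigenvalue {M : ℕ} (hM : 2 ≤ M) {A : Matrix (Fin M) (Fin M) ℝ}
    (hA : A.IsHermitian) : secondSmallestEigenvalue hM hA ≤ largestEigenvalue hM hA :=
  hA.eigenvalues₀_antitone (Fin.mk_le_mk.2 (Nat.zero_le _))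

theorem sum_sq_inner_eigenvectorBasis {M : ℕ} {A : Matrix (Fin M) (Fin M) ℝ} (hA : A.IsHermitian)
    (x : EuclideanSpace ℝ (Fin M)) :
    ∑ i, inner ℝ (hA.eigenvectorBasis i) x ^ 2 = x.ofLp ⬝ᵥ x.ofLp := by
  have := hA.eigenvectorBasis.sum_sq_norm_inner_right x
  simp only [Real.norm_eq_abs, sq_abs] at this
  rw [this, EuclideanSpace.real_norm_sq_eq]
  simp [dotProduct, sq]

theorem largestEigenvalue_le {M : ℕ} (hM : 2 ≤ M) {A : Matrix (Fin M) (Fin M) ℝ}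
    (hA : A.IsHermitian) {c : ℝ} (h : ∀ x : Fin M → ℝ, x ⬝ᵥ (A *ᵥ x) ≤ c * (x ⬝ᵥ x)) :
    largestEigenvalue hM hA ≤ c := by
  set e : Fin (Fintype.card (Fin M)) ≃ Fin M := Fintype.equivOfCardEq (Fintype.card_fin _) with he
  set i : Fin M := e ⟨0, by rw [Fintype.card_fin]; omega⟩ with hi
  have hev : hA.eigenvalues i = largestEigenvalue hM hA := by
    simp [Matrix.IsHermitian.eigenvalues, he, hi, largestEigenvalue]
  have h1 := h (hA.eigenvectorBasis i).ofLp
  rw [hA.mulVec_eigenvectorBasis, dotProduct_smul, hev] at h1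
  have h2 : (hA.eigenvectorBasis i).ofLp ⬝ᵥ (hA.eigenvectorBasis i).ofLp = 1 := by
    have := hA.eigenvectorBasis.orthonormal.norm_eq_one i
    have h3 := EuclideanSpace.real_norm_sq_eq (hA.eigenvectorBasis i)
    rw [this] at h3
    simpa [dotProduct, sq] using h3.symm
  rw [h2] at h1
  simpa using h1

/-- A lower bound for the second smallest eigenvalue from a bound for the quadratic form on a
hyperplane. -/
theorem le_secondSmallestEigenvalue {M : ℕ} (hM : 2 ≤ M) {A : Matrix (Fin M) (Fin M) ℝ}
    (hA : A.IsHermitian) (v : Fin M → ℝ) {c : ℝ}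
    (h : ∀ x : Fin M → ℝ, v ⬝ᵥ x = 0 → c * (x ⬝ᵥ x) ≤ x ⬝ᵥ (A *ᵥ x)) :
    c ≤ secondSmallestEigenvalue hM hA := by
  obtain ⟨i, j, hij, hi, hj, -⟩ := exists_eigenvalues_eq_second hM hA
  set b := hA.eigenvectorBasis with hb
  -- The plane of the two lowest eigenvectors meets the hyperplane orthogonal to `v` in a nonzero
  -- vector, on which the Rayleigh quotient is at most the second eigenvalue.
  obtain ⟨p, q, hpq, h0⟩ : ∃ p q : ℝ, (p ≠ 0 ∨ q ≠ 0) ∧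
      p * (v ⬝ᵥ (b i).ofLp) + q * (v ⬝ᵥ (b j).ofLp) = 0 := by
    by_cases hz : v ⬝ᵥ (b i).ofLp = 0
    · exact ⟨1, 0, Or.inl one_ne_zero, by simp [hz]⟩
    · exact ⟨v ⬝ᵥ (b j).ofLp, -(v ⬝ᵥ (b i).ofLp), Or.inr (neg_ne_zero.2 hz), by ring⟩
  set x : EuclideanSpace ℝ (Fin M) := p • b i + q • b j with hx
  have hx1 := h x.ofLp (by simpa [hx, dotProduct_add, dotProduct_smul] using h0)
  have hin : ∀ k, inner ℝ (b k) x = (if k = i then p else 0) + (if k = j then q else 0) := by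
    intro k
    simp [hx, inner_add_right, inner_smul_right, orthonormal_iff_ite.1 b.orthonormal]
  have hsq : ∀ k, inner ℝ (b k) x ^ 2 = (if k = i then p ^ 2 else 0) + (if k = j then q ^ 2 else 0) := by
    intro k
    rw [hin]
    by_cases h1 : k = i
    · subst h1; simp [hij]
    · by_cases h2 : k = j
      · subst h2; simp [h1]
      · simp [h1, h2]
  rw [quadForm_eq_sum_eigenvalues hA x, ← sum_sq_inner_eigenvectorBasis hA x] at hx1
  simp only [← hb, hsq, mul_add, Finset.sum_add_distrib, mul_ite, mul_zero,
    Finset.sum_ite_eq', Finset.mem_univ, if_true] at hx1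
  have hpos : 0 < p ^ 2 + q ^ 2 := by
    rcases hpq with hp | hq <;> positivity
  rw [hi] at hx1
  nlinarith [mul_nonneg (sub_nonneg.2 hj) (sq_nonneg q)]

/-- The variational inequality for the second smallest eigenvalue of a matrix whose smallest
eigenvalue is known to be zero. -/
theorem secondSmallestEigenvalue_mul_le {M : ℕ} (hM : 2 ≤ M) {A : Matrix (Fin M) (Fin M) ℝ}
    (hA : A.IsHermitian) (hpos : 0 < secondSmallestEigenvalue hM hA) {v : Fin M → ℝ} (hv : v ≠ 0)
    (hAv : A *ᵥ v = 0) {x : Fin M → ℝ} (hx : v ⬝ᵥ x = 0) :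
    secondSmallestEigenvalue hM hA * (x ⬝ᵥ x) ≤ x ⬝ᵥ (A *ᵥ x) := by
  obtain ⟨i, j, hij, hi, hj, hk⟩ := exists_eigenvalues_eq_second hM hA
  set b := hA.eigenvectorBasis with hb
  have h0 : ∀ y z : Fin M → ℝ, inner ℝ (WithLp.toLp 2 y) (WithLp.toLp 2 z) = y ⬝ᵥ z := fun y z => by
    simp [PiLp.inner_apply, dotProduct, mul_comm]
  have hvq := quadForm_eq_sum_eigenvalues hA (WithLp.toLp 2 v)
  have hT : Aᵀ = A := by simpa [conjTranspose_eq_transpose_of_trivial] using hA.eq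
  -- All eigenvalues except the one at `j` are positive, so the kernel vector `v` is a multiple of
  -- `b j`, and orthogonality to `v` removes exactly that component of `x`.
  have hvk : ∀ k, k ≠ j → inner ℝ (b k) (WithLp.toLp 2 v) = 0 := by
    intro k hkj
    have h1 : (b k).ofLp ⬝ᵥ (A *ᵥ v) = 0 := by rw [hAv, dotProduct_zero]
    rw [dotProduct_mulVec, ← mulVec_transpose, hT, hA.mulVec_eigenvectorBasis, smul_dotProduct,
      smul_eq_mul, ← h0] at h1
    exact (mul_eq_zero.1 h1).resolve_left (hpos.trans_le (hk k hkj)).ne'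
  have hvj : inner ℝ (b j) (WithLp.toLp 2 v) ≠ 0 := by
    intro hz
    apply hv
    have : ∀ k, inner ℝ (b k) (WithLp.toLp 2 v) = 0 := fun k => by
      by_cases h : k = j
      · rw [h, hz]
      · exact hvk k h
    have h2 := b.sum_repr' (WithLp.toLp 2 v)
    simp only [this, zero_smul, Finset.sum_const_zero] at h2
    have h3 := congrArg WithLp.ofLp h2
    simpa using h3.symm
  have hxj : inner ℝ (b j) (WithLp.toLp 2 x) = 0 := by
    have h1 := b.sum_inner_mul_inner (WithLp.toLp 2 v) (WithLp.toLp 2 x)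
    rw [h0, hx, Finset.sum_eq_single j] at h1
    · rcases mul_eq_zero.1 h1 with h2 | h2
      · rw [real_inner_comm] at h2
        exact absurd h2 hvj
      · exact h2
    · intro k _ hkj
      rw [real_inner_comm, hvk k hkj, zero_mul]
    · simp
  have h1 := quadForm_eq_sum_eigenvalues hA (WithLp.toLp 2 x)
  have h2 := sum_sq_inner_eigenvectorBasis hA (WithLp.toLp 2 x)
  simp only at h1 h2
  rw [h1, ← h2, Finset.mul_sum]
  refine Finset.sum_le_sum fun k _ => ?_
  by_cases h : k = j
  · rw [h, hxj]; simp
  · exact mul_le_mul_of_nonneg_right (hk k h) (sq_nonneg _)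

end Spectral

/-! ### Poincaré inequality and spectral gap of the path. -/

section PathGraph

open Matrix

/-- The degree factors cancel, so the eigenvalue in the accuracy measure is governed by the
Dirichlet form. -/
theorem scaledLaplacian_eq_lapMatrix {M : ℕ} (G : SimpleGraph (Fin M)) [DecidableRel G.Adj]
    (hd : ∀ i, 0 < G.degree i) :
    sqrtDegree G * normLaplacian G * sqrtDegree G = G.lapMatrix ℝ := by
  ext i j
  have hpos : ∀ i, 0 < √(G.degree i : ℝ) := fun i => Real.sqrt_pos.2 (by exact_mod_cast hd i)
  rw [sqrtDegree, mul_diagonal, diagonal_mul]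
  simp only [normLaplacian, of_apply, SimpleGraph.lapMatrix, SimpleGraph.degMatrix, Matrix.sub_apply,
    diagonal_apply, SimpleGraph.adjMatrix_apply]
  by_cases hij : i = j
  · subst hij
    simp [Real.mul_self_sqrt]
  · by_cases ha : G.Adj i j
    · have h1 := (hpos i).ne'
      have h2 := (hpos j).ne'
      simp only [hij, ha, if_true, if_false, zero_sub]
      rw [Real.sqrt_mul (by positivity)]
      field_simp
    · simp [hij, ha]

/-- The Dirichlet form of a graph, every edge being counted once. -/
def dirichlet {M : ℕ} (G : SimpleGraph (Fin M)) [DecidableRel G.Adj] (z : Fin M → ℝ) : ℝ :=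
  ∑ i, ∑ j with G.Adj i j ∧ i < j, (z i - z j) ^ 2

theorem dotProduct_lapMatrix_mulVec {M : ℕ} (G : SimpleGraph (Fin M)) [DecidableRel G.Adj]
    (z : Fin M → ℝ) : z ⬝ᵥ (G.lapMatrix ℝ *ᵥ z) = dirichlet G z := by
  rw [← toLinearMap₂'_apply', SimpleGraph.lapMatrix_toLinearMap₂']
  have h : ∀ i j, (if G.Adj i j then (z i - z j) ^ 2 else 0) =
      (if G.Adj i j ∧ i < j then (z i - z j) ^ 2 else 0) +
        (if G.Adj j i ∧ j < i then (z j - z i) ^ 2 else 0) := by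
    intro i j
    by_cases ha : G.Adj i j
    · have ha' := ha.symm
      rcases lt_or_gt_of_ne ha.ne with hl | hl
      · simp [ha, hl, hl.not_gt]
      · simp [ha, ha', hl, hl.not_gt]; ring
    · have ha' : ¬G.Adj j i := fun h => ha h.symm
      simp [ha, ha']
  simp only [h, Finset.sum_add_distrib]
  rw [Finset.sum_comm (f := fun i j => if G.Adj j i ∧ j < i then (z j - z i) ^ 2 else 0)]
  simp only [dirichlet, Finset.sum_filter]
  ring

/-- From `(a - b)² ≤ 2a² + 2b²` on each edge; it gives the bound 2 for the largest eigenvalue of the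
normalized Laplacian. -/
theorem dotProduct_lapMatrix_mulVec_le {M : ℕ} (G : SimpleGraph (Fin M)) [DecidableRel G.Adj]
    (z : Fin M → ℝ) : z ⬝ᵥ (G.lapMatrix ℝ *ᵥ z) ≤ 2 * ∑ i, (G.degree i : ℝ) * z i ^ 2 := by
  rw [← toLinearMap₂'_apply', SimpleGraph.lapMatrix_toLinearMap₂']
  have h1 : (∑ i, ∑ j, if G.Adj i j then (z i - z j) ^ 2 else 0) ≤
      ∑ i, ∑ j, ((if G.Adj i j then 2 * z i ^ 2 else 0) + (if G.Adj j i then 2 * z j ^ 2 else 0)) := by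
    refine Finset.sum_le_sum fun i _ => Finset.sum_le_sum fun j _ => ?_
    by_cases ha : G.Adj i j
    · simp only [ha, ha.symm, if_true]
      nlinarith [sq_nonneg (z i + z j)]
    · have ha' : ¬G.Adj j i := fun h => ha h.symm
      simp [ha, ha']
  have h2 : ∑ i, ∑ j, (if G.Adj i j then 2 * z i ^ 2 else 0) =
      2 * ∑ i, (G.degree i : ℝ) * z i ^ 2 := by
    rw [Finset.mul_sum]
    refine Finset.sum_congr rfl fun i _ => ?_
    rw [SimpleGraph.degree_eq_sum_if_adj, Finset.sum_mul, Finset.mul_sum]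
    refine Finset.sum_congr rfl fun j _ => ?_
    split_ifs <;> ring
  simp only [Finset.sum_add_distrib] at h1
  rw [Finset.sum_comm (f := fun i j => if G.Adj j i then 2 * z j ^ 2 else 0), h2] at h1
  linarith

theorem degree_pathGraph_pos {M : ℕ} (hM : 2 ≤ M) (i : Fin M) :
    0 < (SimpleGraph.pathGraph M).degree i := by
  rw [SimpleGraph.degree_pos_iff_exists_adj]
  by_cases h : (i : ℕ) + 1 < M
  · exact ⟨⟨i + 1, h⟩, SimpleGraph.pathGraph_adj.2 (Or.inl rfl)⟩
  · exact ⟨⟨i - 1, by omega⟩, SimpleGraph.pathGraph_adj.2 (Or.inr (by simp only; omega))⟩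

theorem degree_pathGraph_le {M : ℕ} (i : Fin M) : (SimpleGraph.pathGraph M).degree i ≤ 2 := by
  rw [← SimpleGraph.card_neighborFinset_eq_degree, ← Finset.card_map Fin.valEmbedding]
  refine (Finset.card_le_card (t := {(i : ℕ) - 1, (i : ℕ) + 1}) ?_).trans Finset.card_le_two
  intro k hk
  simp only [Finset.mem_map, SimpleGraph.mem_neighborFinset, SimpleGraph.pathGraph_adj] at hk
  obtain ⟨j, hj, rfl⟩ := hk
  simp only [Fin.valEmbedding_apply, Finset.mem_insert, Finset.mem_singleton]
  omega

theorem dirichlet_pathGraph (n : ℕ) (z : Fin (n + 1) → ℝ) :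
    dirichlet (SimpleGraph.pathGraph (n + 1)) z = ∑ i : Fin n, (z i.castSucc - z i.succ) ^ 2 := by
  have h : ∀ i j : Fin (n + 1),
      ((SimpleGraph.pathGraph (n + 1)).Adj i j ∧ i < j) ↔ (i : ℕ) + 1 = j := by
    intro i j
    rw [SimpleGraph.pathGraph_adj, Fin.lt_def]
    omega
  simp only [dirichlet, h]
  rw [Fin.sum_univ_castSucc]
  have hlast : ∑ j ∈ Finset.univ.filter (fun j : Fin (n + 1) => (Fin.last n : ℕ) + 1 = (j : ℕ)),
      (z (Fin.last n) - z j) ^ 2 = 0 := by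
    refine Finset.sum_eq_zero fun j hj => ?_
    have := (Finset.mem_filter.1 hj).2
    have := j.2
    simp only [Fin.val_last] at *
    omega
  rw [hlast, add_zero]
  refine Finset.sum_congr rfl fun i _ => ?_
  rw [Finset.sum_eq_single i.succ]
  · intro j hj hne
    have := (Finset.mem_filter.1 hj).2
    exact absurd (Fin.ext (by simpa using this.symm)) hne
  · intro hn
    simp at hn

/-- Telescope along the path from node 0 and apply Cauchy–Schwarz. -/
theorem sq_sub_le_dirichlet_pathGraph {n : ℕ} (z : Fin (n + 1) → ℝ) (i : Fin (n + 1)) :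
    (z i - z 0) ^ 2 ≤ n * dirichlet (SimpleGraph.pathGraph (n + 1)) z := by
  rw [dirichlet_pathGraph]
  set Z : ℕ → ℝ := fun k => z (Fin.ofNat (n + 1) k) with hZ
  have hZi : Z i = z i := by
    simp [hZ]
  have hZ0 : Z 0 = z 0 := by simp [hZ]
  have hsum : ∑ i : Fin n, (z i.castSucc - z i.succ) ^ 2 =
      ∑ k ∈ Finset.range n, (Z (k + 1) - Z k) ^ 2 := by
    rw [Finset.sum_range]
    refine Finset.sum_congr rfl fun k _ => ?_
    have h1 : Z k = z k.castSucc := by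
      simp only [hZ]; congr 1; ext; simp [Fin.ofNat, Nat.mod_eq_of_lt (show (k : ℕ) < n + 1 by omega)]
    have h2 : Z (k + 1) = z k.succ := by
      simp only [hZ]; congr 1; ext; simp [Fin.ofNat]
    rw [h1, h2]; ring
  have hle : (i : ℕ) ≤ n := Nat.lt_succ_iff.1 i.2
  rw [hsum, ← hZi, ← hZ0, ← Finset.sum_range_sub Z i]
  refine (sq_sum_le_card_mul_sum_sq).trans ?_
  rw [Finset.card_range]
  refine mul_le_mul (by exact_mod_cast hle) ?_ (Finset.sum_nonneg fun _ _ => sq_nonneg _)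
    (Nat.cast_nonneg _)
  exact Finset.sum_le_sum_of_subset_of_nonneg
    (Finset.range_mono hle) fun _ _ _ => sq_nonneg _

/-- A Poincaré inequality on the path graph, for weights at most two. -/
theorem weighted_poincare_pathGraph {M : ℕ} (hM : 2 ≤ M) {d z : Fin M → ℝ} (hd0 : ∀ i, 0 ≤ d i)
    (hd : ∀ i, d i ≤ 2) (hz : ∑ i, d i * z i = 0) :
    ∑ i, d i * z i ^ 2 ≤ 2 * M ^ 2 * dirichlet (SimpleGraph.pathGraph M) z := by
  obtain ⟨n, rfl⟩ : ∃ n, M = n + 1 := ⟨M - 1, by omega⟩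
  set D := dirichlet (SimpleGraph.pathGraph (n + 1)) z with hD
  have hD0 : 0 ≤ D := Finset.sum_nonneg fun _ _ => Finset.sum_nonneg fun _ _ => sq_nonneg _
  -- As the weighted mean vanishes, subtracting a constant can only increase the weighted sum of
  -- squares.
  have h1 : ∑ i, d i * z i ^ 2 ≤ ∑ i, d i * (z i - z 0) ^ 2 := by
    have h2 : ∑ i, d i * (z i - z 0) ^ 2 =
        ∑ i, d i * z i ^ 2 - 2 * z 0 * ∑ i, d i * z i + z 0 ^ 2 * ∑ i, d i := by
      rw [Finset.mul_sum, Finset.mul_sum, ← Finset.sum_sub_distrib, ← Finset.sum_add_distrib]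
      exact Finset.sum_congr rfl fun i _ => by ring
    rw [h2, hz]
    have := mul_nonneg (sq_nonneg (z 0)) (Finset.sum_nonneg fun i (_ : i ∈ Finset.univ) => hd0 i)
    linarith
  have h3 : ∑ i, d i * (z i - z 0) ^ 2 ≤ ∑ _i : Fin (n + 1), 2 * ((n + 1 : ℕ) * D) := by
    refine Finset.sum_le_sum fun i _ => ?_
    refine mul_le_mul (hd i) ?_ (sq_nonneg _) zero_le_two
    refine (sq_sub_le_dirichlet_pathGraph z i).trans ?_
    exact mul_le_mul_of_nonneg_right (by push_cast; linarith) hD0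
  refine (h1.trans h3).trans (le_of_eq ?_)
  simp only [Finset.sum_const, Finset.card_univ, Fintype.card_fin, nsmul_eq_mul]
  ring

/-- Besides making the division in `localError` meaningful, positivity supplies the hypothesis of
`secondSmallestEigenvalue_mul_le`. -/
theorem secondSmallest_scaledLaplacian_pos {M : ℕ} (hM : 2 ≤ M) :
    0 < secondSmallestEigenvalue hM (scaledLaplacian_isHermitian (SimpleGraph.pathGraph M)) := by
  have hM0 : (0 : ℝ) < M := by exact_mod_cast (by omega : 0 < M)
  refine (show (0 : ℝ) < 1 / (2 * M ^ 2) by positivity).trans_le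
    (le_secondSmallestEigenvalue hM _ (fun _ => 1) fun x hx => ?_)
  rw [scaledLaplacian_eq_lapMatrix _ (degree_pathGraph_pos hM), dotProduct_lapMatrix_mulVec]
  have h := weighted_poincare_pathGraph hM (d := fun _ => 1) (z := x) (fun _ => zero_le_one)
    (fun _ => one_le_two) (by simpa [dotProduct] using hx)
  have e : x ⬝ᵥ x = ∑ i, 1 * x i ^ 2 := by simp [dotProduct, sq]
  rw [e, div_mul_eq_mul_div, one_mul, div_le_iff₀ (by positivity)]
  linarith

/-- The Poincaré inequality for the path graph, with the constant given by the second smallest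
eigenvalue of the Laplacian. -/
theorem poincare_pathGraph {M : ℕ} (hM : 2 ≤ M) {x : Fin M → ℝ} (hx : ∑ i, x i = 0) :
    secondSmallestEigenvalue hM (scaledLaplacian_isHermitian (SimpleGraph.pathGraph M)) *
      ∑ i, x i ^ 2 ≤ dirichlet (SimpleGraph.pathGraph M) x := by
  have h := secondSmallestEigenvalue_mul_le hM
    (scaledLaplacian_isHermitian (SimpleGraph.pathGraph M))
    (secondSmallest_scaledLaplacian_pos hM) (v := fun _ => 1)
    (fun h0 => one_ne_zero (congrFun h0 ⟨0, by omega⟩))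
    (by rw [scaledLaplacian_eq_lapMatrix _ (degree_pathGraph_pos hM)]
        exact SimpleGraph.lapMatrix_mulVec_const_eq_zero _)
    (x := x) (by simpa [dotProduct] using hx)
  rw [← dotProduct_lapMatrix_mulVec,
    ← scaledLaplacian_eq_lapMatrix _ (degree_pathGraph_pos hM)]
  have e : x ⬝ᵥ x = ∑ i, x i ^ 2 := by simp [dotProduct, sq]
  rwa [e] at h

/-- The substitution `x = P^{1/2} z` turns the Rayleigh quotient of the normalized Laplacian into
the Dirichlet form over the degree-weighted norm. -/
theorem dotProduct_normLaplacian_mulVec {M : ℕ} (G : SimpleGraph (Fin M)) [DecidableRel G.Adj]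
    (hd : ∀ i, 0 < G.degree i) (z : Fin M → ℝ) :
    (fun i => √(G.degree i : ℝ) * z i) ⬝ᵥ (normLaplacian G *ᵥ fun i => √(G.degree i : ℝ) * z i) =
      z ⬝ᵥ (G.lapMatrix ℝ *ᵥ z) := by
  have h1 : (fun i => √(G.degree i : ℝ) * z i) = sqrtDegree G *ᵥ z := by
    ext i
    rw [sqrtDegree, mulVec_diagonal]
  have h2 : (sqrtDegree G)ᵀ = sqrtDegree G := diagonal_transpose _
  rw [h1, ← scaledLaplacian_eq_lapMatrix G hd, ← mulVec_mulVec, ← mulVec_mulVec,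
    dotProduct_mulVec z, ← mulVec_transpose, h2]

/-- The second eigenvalue is at least `1 / (2 * M ^ 2)` by the degree-weighted Poincaré inequality,
and the largest is at most 2. These crude bounds have the right order in `M`. -/
theorem inv_le_sqrt_spectralGap_pathGraph {M : ℕ} (hM : 2 ≤ M) :
    1 / (2 * (M : ℝ)) ≤ √(spectralGap hM (SimpleGraph.pathGraph M)) := by
  have hM0 : (0 : ℝ) < M := by exact_mod_cast (by omega : 0 < M)
  set G := SimpleGraph.pathGraph M with hG
  have hdeg : ∀ i, 0 < G.degree i := degree_pathGraph_pos hM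
  have hpos : ∀ i, 0 < √(G.degree i : ℝ) := fun i => Real.sqrt_pos.2 (by exact_mod_cast hdeg i)
  have hrep : ∀ x : Fin M → ℝ, ∃ z : Fin M → ℝ, x = fun i => √(G.degree i : ℝ) * z i := fun x =>
    ⟨fun i => x i / √(G.degree i : ℝ), by ext i; rw [mul_div_cancel₀ _ (hpos i).ne']⟩
  have hnorm : ∀ z : Fin M → ℝ, (fun i => √(G.degree i : ℝ) * z i) ⬝ᵥ
      (fun i => √(G.degree i : ℝ) * z i) = ∑ i, (G.degree i : ℝ) * z i ^ 2 := fun z =>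
    Finset.sum_congr rfl fun i _ => by
      rw [mul_mul_mul_comm, Real.mul_self_sqrt (Nat.cast_nonneg _), sq]
  have hlow : 1 / (2 * (M : ℝ) ^ 2) ≤
      secondSmallestEigenvalue hM (normLaplacian_isHermitian G) := by
    refine le_secondSmallestEigenvalue hM _ (fun i => √(G.degree i : ℝ)) fun x hx => ?_
    obtain ⟨z, rfl⟩ := hrep x
    rw [dotProduct_normLaplacian_mulVec G hdeg, dotProduct_lapMatrix_mulVec, hnorm]
    have hz : ∑ i, (G.degree i : ℝ) * z i = 0 := by
      rw [← hx]
      refine Finset.sum_congr rfl fun i _ => ?_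
      rw [← mul_assoc, Real.mul_self_sqrt (Nat.cast_nonneg _)]
    have h := weighted_poincare_pathGraph hM (fun i => Nat.cast_nonneg _)
      (fun i => by exact_mod_cast degree_pathGraph_le i) hz
    rw [div_mul_eq_mul_div, one_mul, div_le_iff₀ (by positivity)]
    linarith
  have hup : largestEigenvalue hM (normLaplacian_isHermitian G) ≤ 2 := by
    refine largestEigenvalue_le hM _ fun x => ?_
    obtain ⟨z, rfl⟩ := hrep x
    rw [dotProduct_normLaplacian_mulVec G hdeg, hnorm]
    exact dotProduct_lapMatrix_mulVec_le G z
  have hpos2 : 0 < largestEigenvalue hM (normLaplacian_isHermitian G) :=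
    (show (0 : ℝ) < 1 / (2 * (M : ℝ) ^ 2) by positivity).trans_le
      (hlow.trans (second_le_largestEigenvalue hM _))
  refine Real.le_sqrt_of_sq_le ?_
  have e : (1 / (2 * (M : ℝ))) ^ 2 = 1 / (2 * (M : ℝ) ^ 2) / 2 := by field_simp
  rw [e, spectralGap]
  exact div_le_div₀ ((by positivity : (0 : ℝ) ≤ 1 / (2 * (M : ℝ) ^ 2)).trans hlow) hlow hpos2 hup

end PathGraph

/-! ### Coordinates with respect to an orthonormal frame. -/

section Frame

/-- `e, u 0, …, u (N - 1)` are orthonormal, and `u k = 0` for `k ≥ N`. -/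
structure IsFrame {S : ℕ} (e : E S) (u : ℕ → E S) (N : ℕ) : Prop where
  norm_left : ‖e‖ = 1
  inner_left : ∀ k, inner ℝ e (u k) = 0
  inner_right : ∀ j k, inner ℝ (u j) (u k) = if j = k ∧ k < N then 1 else 0

/-- The vector with the given coordinates in a frame. -/
noncomputable def frameVec {S : ℕ} (e : E S) (u : ℕ → E S) (N : ℕ) (α : ℝ) (β : ℕ → ℝ) : E S :=
  α • e + ∑ k ∈ Finset.range N, β k • u k

variable {S : ℕ} {e : E S} {u : ℕ → E S} {N : ℕ}

theorem frameVec_sub (α α' : ℝ) (β β' : ℕ → ℝ) :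
    frameVec e u N α β - frameVec e u N α' β' =
      frameVec e u N (α - α') fun k => β k - β' k := by
  simp only [frameVec, sub_smul, Finset.sum_sub_distrib]
  abel

theorem IsFrame.eq_zero (h : IsFrame e u N) {k : ℕ} (hk : N ≤ k) : u k = 0 := by
  rw [← inner_self_eq_zero (𝕜 := ℝ), h.inner_right]
  simp [hk.not_gt]

theorem IsFrame.inner_left_frameVec (h : IsFrame e u N) (α : ℝ) (β : ℕ → ℝ) :
    inner ℝ e (frameVec e u N α β) = α := by
  simp [frameVec, inner_add_right, inner_smul_right, inner_sum, h.inner_left, h.norm_left]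

theorem IsFrame.inner_frameVec (h : IsFrame e u N) (α : ℝ) (β : ℕ → ℝ) {k : ℕ} (hk : k < N) :
    inner ℝ (u k) (frameVec e u N α β) = β k := by
  have h0 : inner ℝ (u k) e = 0 := by rw [real_inner_comm]; exact h.inner_left k
  simp only [frameVec, inner_add_right, inner_smul_right, inner_sum, h0, h.inner_right, mul_zero,
    zero_add]
  rw [Finset.sum_eq_single k]
  · simp [hk]
  · intro j _ hj
    simp [Ne.symm hj]
  · simp [hk]

theorem inner_frameVec_right (x : E S) (α : ℝ) (β : ℕ → ℝ) :
    inner ℝ x (frameVec e u N α β) =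
      α * inner ℝ e x + ∑ k ∈ Finset.range N, β k * inner ℝ (u k) x := by
  simp [frameVec, inner_add_right, inner_smul_right, inner_sum, real_inner_comm]

theorem IsFrame.norm_frameVec_sq (h : IsFrame e u N) (α : ℝ) (β : ℕ → ℝ) :
    ‖frameVec e u N α β‖ ^ 2 = α ^ 2 + ∑ k ∈ Finset.range N, β k ^ 2 := by
  rw [← real_inner_self_eq_norm_sq, inner_frameVec_right, h.inner_left_frameVec, sq]
  congr 1
  refine Finset.sum_congr rfl fun k hk => ?_
  rw [h.inner_frameVec _ _ (Finset.mem_range.1 hk), sq]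

theorem IsFrame.bessel (h : IsFrame e u N) (x : E S) :
    inner ℝ e x ^ 2 + ∑ k ∈ Finset.range N, inner ℝ (u k) x ^ 2 ≤ ‖x‖ ^ 2 := by
  set p := frameVec e u N (inner ℝ e x) fun k => inner ℝ (u k) x with hp
  have h1 : ‖p‖ ^ 2 = inner ℝ e x ^ 2 + ∑ k ∈ Finset.range N, inner ℝ (u k) x ^ 2 :=
    h.norm_frameVec_sq _ _
  have h2 : inner ℝ x p = ‖p‖ ^ 2 := by
    rw [h1, hp, inner_frameVec_right]
    simp only [sq]
  have h3 := norm_sub_sq_real x p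
  rw [h2] at h3
  have h4 := sq_nonneg ‖x - p‖
  linarith

end Frame

/-! ### The hard component functions. -/

section Component

/-- A hard component function: a quadratic in the direction `e` plus a rescaled chain function
in the directions `u k`. -/
noncomputable def component {S : ℕ} (e : E S) (u : ℕ → E S) (N : ℕ) (U σ a : ℝ) (w : ℕ → ℝ)
    (x : E S) : ℝ :=
  U / 2 * (inner ℝ e x - a) ^ 2 + U * σ ^ 2 / 14 * chain w N fun k => inner ℝ (u k) x / σ

variable {S : ℕ} {e : E S} {u : ℕ → E S} {N : ℕ} {U σ a : ℝ} {w : ℕ → ℝ}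

theorem hasGradientAt_component (hσ : 0 < σ) (hwN : w N = 0) (x : E S) :
    HasGradientAt (component e u N U σ a w)
      (frameVec e u N (U * (inner ℝ e x - a)) fun k =>
        U * σ / 14 * chainSlope w (fun k => inner ℝ (u k) x / σ) k) x := by
  rw [hasGradientAt_iff_hasFDerivAt]
  have hin : ∀ v : E S, HasFDerivAt (fun x => inner ℝ v x) (innerSL ℝ v) x := fun v =>
    (innerSL ℝ v).hasFDerivAt
  have h1 : HasFDerivAt (fun x => U / 2 * (inner ℝ e x - a) ^ 2)
      ((U / 2) • ((2 * (inner ℝ e x - a)) • innerSL ℝ e)) x := by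
    have := (((hin e).sub_const a).pow 2).const_mul (U / 2)
    simpa [pow_one] using this
  have h2 := (hasFDerivAt_chain (N := N) hwN (y := fun x k => inner ℝ (u k) x / σ)
    (y' := fun k => σ⁻¹ • innerSL ℝ (u k)) (x := x) (fun k => by
      simpa [div_eq_inv_mul] using (hin (u k)).const_mul σ⁻¹)).const_mul (U * σ ^ 2 / 14)
  refine (h1.add h2).congr_fderiv ?_
  ext z
  simp only [add_apply, smul_apply, innerSL_apply_apply,
    sum_apply, smul_eq_mul, InnerProductSpace.toDual_apply_apply]
  rw [real_inner_comm z (frameVec _ _ _ _ _), inner_frameVec_right, Finset.mul_sum]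
  congr 1
  · ring
  · refine Finset.sum_congr rfl fun k _ => ?_
    field_simp

theorem gradient_component (hσ : 0 < σ) (hwN : w N = 0) (x : E S) :
    gradient (component e u N U σ a w) x =
      frameVec e u N (U * (inner ℝ e x - a)) fun k =>
        U * σ / 14 * chainSlope w (fun k => inner ℝ (u k) x / σ) k :=
  (hasGradientAt_component hσ hwN x).gradient

/-- The quadratic and the chain depend on orthogonal directions, so their constants combine as a
maximum. Both equal `U`: the scaling `U * σ ^ 2 / 14` compensates for the inner factor `1 / σ` and
the chain's constant 14. -/
theorem norm_gradient_component_sub_le (h : IsFrame e u N) (hU : 0 < U) (hσ : 0 < σ)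
    (hw : ∀ k, 0 ≤ w k) (hw1 : ∀ k, w k ≤ 1) (hwN : w N = 0) (x z : E S) :
    ‖gradient (component e u N U σ a w) x - gradient (component e u N U σ a w) z‖ ≤
      U * ‖x - z‖ := by
  rw [gradient_component hσ hwN, gradient_component hσ hwN, frameVec_sub]
  refine le_of_sq_le_sq ?_ (by positivity)
  rw [h.norm_frameVec_sq, mul_pow]
  have h1 := sum_chainSlope_sub_sq_le hw hw1 (N := N) (y := fun k => inner ℝ (u k) x / σ)
    (z := fun k => inner ℝ (u k) z / σ) (by simp [h.eq_zero le_rfl])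
  have h2 : ∑ k ∈ Finset.range N, (inner ℝ (u k) x / σ - inner ℝ (u k) z / σ) ^ 2 =
      (∑ k ∈ Finset.range N, inner ℝ (u k) (x - z) ^ 2) / σ ^ 2 := by
    rw [Finset.sum_div]
    refine Finset.sum_congr rfl fun k _ => ?_
    rw [inner_sub_right, ← sub_div, div_pow]
  rw [h2] at h1
  have h3 := h.bessel (x - z)
  simp only [← mul_sub, mul_pow, ← Finset.mul_sum]
  have h4 : inner ℝ e x - a - (inner ℝ e z - a) = inner ℝ e (x - z) := by
    rw [inner_sub_right]; ring
  rw [h4]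
  have h5 : (U * σ / 14) ^ 2 * (14 ^ 2 * ((∑ k ∈ Finset.range N, inner ℝ (u k) (x - z) ^ 2) / σ ^ 2)) =
      U ^ 2 * ∑ k ∈ Finset.range N, inner ℝ (u k) (x - z) ^ 2 := by
    field_simp
  have h6 := mul_le_mul_of_nonneg_left h1 (sq_nonneg (U * σ / 14))
  rw [h5] at h6
  have h7 := mul_le_mul_of_nonneg_left h3 (sq_nonneg U)
  simp only [mul_pow, div_pow] at h6 ⊢
  linarith

/-- For sharpness, compare the gradients at `e` and 0: the chain does not see this move, and the
quadratic changes its gradient by exactly `U`. -/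
theorem isGradLipschitzConst_component (h : IsFrame e u N) (hU : 0 < U) (hσ : 0 < σ)
    (hw : ∀ k, 0 ≤ w k) (hw1 : ∀ k, w k ≤ 1) (hwN : w N = 0) :
    IsGradLipschitzConst (component e u N U σ a w) U := by
  refine ⟨⟨hU.le, norm_gradient_component_sub_le h hU hσ hw hw1 hwN⟩, ?_⟩
  rintro K ⟨hK0, hK⟩
  have h1 := hK e 0
  rw [gradient_component hσ hwN, gradient_component hσ hwN, frameVec_sub, sub_zero, h.norm_left,
    mul_one] at h1
  have h2 : ∀ k, inner ℝ (u k) e = 0 := fun k => by rw [real_inner_comm]; exact h.inner_left k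
  have h3 := h.norm_frameVec_sq (U * (inner ℝ e e - a) - U * (inner ℝ e 0 - a)) (fun k =>
    U * σ / 14 * chainSlope w (fun k => inner ℝ (u k) e / σ) k -
      U * σ / 14 * chainSlope w (fun k => inner ℝ (u k) 0 / σ) k)
  simp only [h2, inner_zero_right, sub_self, real_inner_self_eq_norm_sq, h.norm_left] at h3 h1
  refine (abs_le_of_sq_le_sq' ?_ hK0).2
  calc U ^ 2 = _ := by rw [h3]; simp; ring
    _ ≤ K ^ 2 := pow_le_pow_left₀ (norm_nonneg _) h1 2

theorem le_component (hU : 0 < U) (hw1 : ∀ k, w k ≤ 1) (x : E S) :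
    -(U * σ ^ 2 / 7 * N) ≤ component e u N U σ a w x := by
  have h1 := mul_le_mul_of_nonneg_left (le_chain hw1 N fun k => inner ℝ (u k) x / σ)
    (by positivity : 0 ≤ U * σ ^ 2 / 14)
  have h2 : 0 ≤ U / 2 * (inner ℝ e x - a) ^ 2 := by positivity
  unfold component
  linarith

theorem component_add_smul (h : IsFrame e u N) (x : E S) :
    component e u N U σ a w (x + a • e) = component e u N U σ 0 w x := by
  have h2 : ∀ k, inner ℝ (u k) e = 0 := fun k => by rw [real_inner_comm]; exact h.inner_left k
  simp [component, inner_add_right, inner_smul_right, h.norm_left, h2]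

theorem component_zero : component e u N U σ a w 0 =
    U / 2 * a ^ 2 + U * σ ^ 2 / 14 * chain w N 0 := by
  simp only [component, inner_zero_right, zero_sub, zero_div, neg_sq]
  rfl

theorem norm_gradient_component_zero_sq (h : IsFrame e u N) (hσ : 0 < σ) (hwN : w N = 0) :
    ‖gradient (component e u N U σ a w) 0‖ ^ 2 =
      U ^ 2 * a ^ 2 + (U * σ / 14) ^ 2 * ∑ k ∈ Finset.range N, chainSlope w 0 k ^ 2 := by
  rw [gradient_component hσ hwN, h.norm_frameVec_sq]
  simp only [inner_zero_right, zero_sub, zero_div, mul_pow, neg_sq, ← Finset.mul_sum]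
  rfl

/-- The zero-chain property at one node. Directions beyond `k` are inactive because their
predecessors vanish; direction `k` is inactive if the node does not hold that link or its
predecessor is still unseen. -/
theorem gradient_component_mem (hσ : 0 < σ) (hwN : w N = 0) {V : Submodule ℝ (E S)} (he : e ∈ V)
    {k : ℕ} (hV : ∀ j < k, u j ∈ V) {x : E S} (hx : ∀ j, k ≤ j → inner ℝ (u j) x = 0)
    (hk : w k = 0 ∨ ∃ j, k = j + 1 ∧ inner ℝ (u j) x = 0) :
    gradient (component e u N U σ a w) x ∈ V := by
  rw [gradient_component hσ hwN]
  refine V.add_mem (V.smul_mem _ he) (V.sum_mem fun j _ => ?_)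
  rcases lt_or_ge j k with hj | hj
  · exact V.smul_mem _ (hV j hj)
  · have h0 : chainSlope w (fun k => inner ℝ (u k) x / σ) j = 0 := by
      refine chainSlope_eq_zero (by simp [hx j hj]) ?_
      rcases eq_or_lt_of_le hj with rfl | hlt
      · rcases hk with hk | ⟨i, rfl, hi⟩
        · exact Or.inl hk
        · exact Or.inr (by simp [activation, hi, step_of_nonpos le_rfl])
      · obtain ⟨i, rfl⟩ : ∃ i, j = i + 1 := ⟨j - 1, by omega⟩
        exact Or.inr (by simp [activation, hx i (by omega), step_of_nonpos le_rfl])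
    simp only [h0, mul_zero, zero_smul]
    exact V.zero_mem

end Component

/-! ### Initial gap and averaged gradient of the family. -/

section Family

variable {M S : ℕ} {e : E S} {u : ℕ → E S} {N : ℕ} {U σ a : ℝ} {w : Fin M → ℕ → ℝ}

theorem le_objective_component (hM : 0 < M) (hU : 0 < U) (hw1 : ∀ i k, w i k ≤ 1)
    (x : Fin M → E S) :
    -(U * σ ^ 2 / 7 * N) ≤ objective (fun i => component e u N U σ a (w i)) x := by
  have hM0 : (0 : ℝ) < M := by exact_mod_cast hM
  have h := Finset.card_nsmul_le_sum Finset.univ (fun i => component e u N U σ a (w i) (x i)) _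
    fun i _ => le_component hU (hw1 i) (x i)
  rw [Finset.card_univ, Fintype.card_fin, nsmul_eq_mul] at h
  rw [objective, one_div, ← div_eq_inv_mul, le_div_iff₀ hM0]
  linarith

theorem problemClass_component (hM : 0 < M) (h : IsFrame e u N) (hU : 0 < U) (hσ : 0 < σ)
    (hw : ∀ i k, 0 ≤ w i k) (hw1 : ∀ i k, w i k ≤ 1) (hwN : ∀ i, w i N = 0) :
    ProblemClass U fun i => component e u N U σ a (w i) where
  differentiable i x := (hasGradientAt_component hσ (hwN i) x).differentiableAt
  gradLipschitz i := isGradLipschitzConst_component h hU hσ (hw i) (hw1 i) (hwN i)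
  bddBelow := ⟨_, by rintro _ ⟨x, rfl⟩; exact le_objective_component hM hU hw1 x⟩

theorem iInf_objective_component (h : IsFrame e u N) :
    ⨅ x, objective (fun i => component e u N U σ a (w i)) x =
      ⨅ x, objective (fun i => component e u N U σ 0 (w i)) x := by
  refine (Equiv.iInf_congr (Equiv.addRight fun _ : Fin M => a • e) fun x => ?_).symm
  simp [objective, component_add_smul h]

/-- The offset leaves the infimum unchanged, being a translation along `e`. It adds `U * a ^ 2 / 2`
to the value at zero and `U * a ^ 2` to the gradient term. -/
theorem initialGap_component (hM : 0 < M) (h : IsFrame e u N) (hU : 0 < U) (hσ : 0 < σ)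
    (hwN : ∀ i, w i N = 0) :
    initialGap U (fun i => component e u N U σ a (w i)) =
      initialGap U (fun i => component e u N U σ 0 (w i)) + 3 / 2 * U * a ^ 2 := by
  have hM0 : (0 : ℝ) < M := by exact_mod_cast hM
  unfold initialGap
  rw [iInf_objective_component h]
  simp only [objective, Pi.zero_apply, component_zero,
    norm_gradient_component_zero_sq h hσ (hwN _), Finset.sum_add_distrib, Finset.sum_const,
    Finset.card_univ, Fintype.card_fin, nsmul_eq_mul]
  field_simp
  ring

/-- The infimum costs at most 1/7 and the gradient at zero 1/196, in units of `U * σ ^ 2 * N`;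
together they stay below 1/6. -/
theorem initialGap_component_le (hM : 0 < M) (h : IsFrame e u N) (hU : 0 < U) (hσ : 0 < σ)
    (hw : ∀ i k, 0 ≤ w i k) (hw1 : ∀ i k, w i k ≤ 1) (hwN : ∀ i, w i N = 0) :
    initialGap U (fun i => component e u N U σ 0 (w i)) ≤ U * σ ^ 2 * N / 6 := by
  have hM0 : (0 : ℝ) < M := by exact_mod_cast hM
  have h1 : objective (fun i => component e u N U σ 0 (w i)) 0 ≤ 0 := by
    refine mul_nonpos_of_nonneg_of_nonpos (by positivity) (Finset.sum_nonpos fun i _ => ?_)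
    simp only [Pi.zero_apply, component_zero]
    have := mul_nonpos_of_nonneg_of_nonpos (by positivity : 0 ≤ U * σ ^ 2 / 14)
      (chain_zero_le (hw i) N)
    linarith
  have h2 : -(U * σ ^ 2 / 7 * N) ≤ ⨅ x, objective (fun i => component e u N U σ 0 (w i)) x :=
    le_ciInf fun x => le_objective_component hM hU hw1 x
  have h3 : ∑ i, ‖gradient (component e u N U σ 0 (w i)) 0‖ ^ 2 ≤
      ∑ _i : Fin M, (U * σ / 14) ^ 2 * N := by
    refine Finset.sum_le_sum fun i _ => ?_
    rw [norm_gradient_component_zero_sq h hσ (hwN i)]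
    have h4 : ∑ k ∈ Finset.range N, chainSlope (w i) 0 k ^ 2 ≤ ∑ _k ∈ Finset.range N, (1 : ℝ) :=
      Finset.sum_le_sum fun k _ =>
        (sq_le_one_iff_abs_le_one _).2 (abs_chainSlope_zero_le (hw i) (hw1 i) k)
    simp only [Finset.sum_const, Finset.card_range, nsmul_eq_mul, mul_one] at h4
    have := mul_le_mul_of_nonneg_left h4 (sq_nonneg (U * σ / 14))
    linarith
  have h5 : (∑ i, ‖gradient (component e u N U σ 0 (w i)) 0‖ ^ 2) / (M * U) ≤
      U * σ ^ 2 * N / 196 := by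
    rw [div_le_iff₀ (by positivity)]
    refine h3.trans (le_of_eq ?_)
    simp only [Finset.sum_const, Finset.card_univ, Fintype.card_fin, nsmul_eq_mul]
    ring
  have h6 : 0 ≤ U * σ ^ 2 * N := by positivity
  unfold initialGap
  linarith

/-- As long as the last direction of the chain is not seen, the averaged gradient at a common
point is large. -/
theorem le_norm_average_gradient_component (hM : 0 < M) (h : IsFrame e u N) (hU : 0 < U)
    (hσ : 0 < σ) (hN : 0 < N) (hw : ∀ i k, 0 ≤ w i k) (hwN : ∀ i, w i N = 0)
    (hmass : ∀ k < N, (M : ℝ) / 3 ≤ ∑ i, w i k) {x : E S} (hx : inner ℝ (u (N - 1)) x = 0) :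
    U * σ / 42 ≤
      ‖(1 / (M : ℝ)) • ∑ i, gradient (component e u N U σ a (w i)) x‖ := by
  have hM0 : (0 : ℝ) < M := by exact_mod_cast hM
  -- The slopes are affine in the weights, so averaging over nodes at a common point gives the chain
  -- with averaged weights, which are at least 1/3 on every link.
  set W : ℕ → ℝ := fun k => (1 / (M : ℝ)) * ∑ i, w i k with hW
  set y : ℕ → ℝ := fun k => inner ℝ (u k) x / σ with hy
  obtain ⟨k, hkN, hk⟩ := exists_chainSlope_le (w := W) (κ := 1 / 3) hN (by norm_num) (by norm_num)
    (fun k => mul_nonneg (by positivity) (Finset.sum_nonneg fun i _ => hw i k))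
    (fun k hk => by
      have := mul_le_mul_of_nonneg_left (hmass k hk) (by positivity : 0 ≤ 1 / (M : ℝ))
      calc (1 : ℝ) / 3 = 1 / M * (M / 3) := by field_simp
        _ ≤ _ := this) (y := y) (by simp [hy, hx])
  have hslope : chainSlope W y k = (1 / (M : ℝ)) * ∑ i, chainSlope (w i) y k := by
    simp only [chainSlope, hW, Finset.sum_sub_distrib, Finset.sum_const, Finset.card_univ,
      Fintype.card_fin, nsmul_eq_mul, ← Finset.sum_mul]
    field_simp
  have hinner : inner ℝ (u k) ((1 / (M : ℝ)) • ∑ i, gradient (component e u N U σ a (w i)) x) =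
      U * σ / 14 * chainSlope W y k := by
    rw [inner_smul_right, inner_sum, hslope]
    simp only [gradient_component hσ (hwN _), h.inner_frameVec _ _ hkN, ← Finset.mul_sum]
    ring
  have hnorm : ‖u k‖ = 1 := by
    have := h.inner_right k k
    rw [real_inner_self_eq_norm_sq] at this
    simp only [hkN, and_self, if_true] at this
    exact (pow_eq_one_iff_of_nonneg (norm_nonneg _) two_ne_zero).1 this
  have hcs := abs_real_inner_le_norm (u k)
    ((1 / (M : ℝ)) • ∑ i, gradient (component e u N U σ a (w i)) x)
  rw [hinner, hnorm, one_mul] at hcs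
  refine le_trans ?_ ((neg_le_abs _).trans hcs)
  have := mul_le_mul_of_nonneg_left hk (by positivity : 0 ≤ U * σ / 14)
  linarith

end Family

/-! ### Directions hidden from finitely many operators. -/

section Reach

open Module

/-- The subspace generated by `V` and its images under a family of linear operators. -/
def enlarge {ι X : Type*} [AddCommGroup X] [Module ℝ X] (ops : ι → X →ₗ[ℝ] X)
    (V : Submodule ℝ X) : Submodule ℝ X :=
  V ⊔ ⨆ i, V.map (ops i)

variable {ι X : Type*} [AddCommGroup X] [Module ℝ X] (ops : ι → X →ₗ[ℝ] X)

theorem le_enlarge (V : Submodule ℝ X) : V ≤ enlarge ops V := le_sup_left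

theorem apply_mem_enlarge {V : Submodule ℝ X} {x : X} (hx : x ∈ V) (i : ι) :
    ops i x ∈ enlarge ops V :=
  (le_sup_right : _ ≤ enlarge ops V)
    ((le_iSup (fun i => V.map (ops i)) i) (Submodule.mem_map_of_mem hx))

theorem enlarge_mono {V W : Submodule ℝ X} (h : V ≤ W) : enlarge ops V ≤ enlarge ops W :=
  sup_le_sup h (iSup_mono fun _ => Submodule.map_mono h)

theorem iterate_enlarge_mono {V W : Submodule ℝ X} (h : V ≤ W) (t : ℕ) :
    (enlarge ops)^[t] V ≤ (enlarge ops)^[t] W :=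
  (show Monotone (enlarge ops) from fun _ _ => enlarge_mono ops).iterate t h

theorem iterate_enlarge_le (V : Submodule ℝ X) {s t : ℕ} (h : s ≤ t) :
    (enlarge ops)^[s] V ≤ (enlarge ops)^[t] V :=
  monotone_nat_of_le_succ (f := fun n => (enlarge ops)^[n] V) (fun n => by
    simp only [Function.iterate_succ_apply']
    exact le_enlarge ops _) h

theorem finrank_enlarge_le [Fintype ι] [FiniteDimensional ℝ X] (V : Submodule ℝ X) :
    finrank ℝ (enlarge ops V) ≤ (1 + Fintype.card ι) * finrank ℝ V := by
  classical
  have h : ∀ s : Finset ι, finrank ℝ (s.sup fun i => V.map (ops i) : Submodule ℝ X) ≤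
      s.card * finrank ℝ V := by
    intro s
    induction s using Finset.induction_on with
    | empty => simp
    | insert i s hi ih =>
      rw [Finset.sup_insert, Finset.card_insert_of_notMem hi]
      have h1 := Submodule.finrank_add_le_finrank_add_finrank (V.map (ops i))
        (s.sup fun i => V.map (ops i))
      have h2 := Submodule.finrank_map_le (ops i) V
      nlinarith
  have h1 := Submodule.finrank_add_le_finrank_add_finrank V (⨆ i, V.map (ops i))
  have h2 := h Finset.univ
  rw [Finset.sup_univ_eq_iSup, Finset.card_univ] at h2
  unfold enlarge
  nlinarith

theorem finrank_iterate_enlarge_le [Fintype ι] [FiniteDimensional ℝ X] (V : Submodule ℝ X)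
    (t : ℕ) : finrank ℝ ((enlarge ops)^[t] V) ≤ (1 + Fintype.card ι) ^ t * finrank ℝ V := by
  induction t with
  | zero => rw [pow_zero, one_mul]; exact le_rfl
  | succ t ih =>
    rw [Function.iterate_succ_apply', pow_succ', mul_assoc]
    exact (finrank_enlarge_le ops _).trans (Nat.mul_le_mul_left _ ih)

/-- In a space of large dimension there are unit vectors each of which is orthogonal to everything
that is reached from its predecessors. -/
theorem exists_orthogonal_sequence {S : ℕ} (Φ : Submodule ℝ (E S) → Submodule ℝ (E S)) {C : ℕ}
    (hΦ : ∀ V, finrank ℝ (Φ V) ≤ C * finrank ℝ V) (n : ℕ) (hn : C * n < S) :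
    ∃ v : ℕ → E S, (∀ k < n, ‖v k‖ = 1 ∧ v k ∈ (Φ (Submodule.span ℝ (v '' Set.Iio k)))ᗮ) ∧
      ∀ k, n ≤ k → v k = 0 := by
  classical
  induction n with
  | zero => exact ⟨fun _ => 0, fun k hk => absurd hk (Nat.not_lt_zero k), fun _ _ => rfl⟩
  | succ n ih =>
    obtain ⟨v, hv, hv0⟩ := ih (by nlinarith)
    set V := Submodule.span ℝ (v '' Set.Iio n) with hV
    have hfin : finrank ℝ V ≤ n := by
      have h := finrank_span_finset_le_card (R := ℝ) ((Finset.range n).image v)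
      rw [Finset.coe_image, Finset.coe_range] at h
      exact h.trans (Finset.card_image_le.trans (Finset.card_range n).le)
    have hlt : finrank ℝ (Φ V) < S :=
      ((hΦ V).trans (Nat.mul_le_mul_left C hfin)).trans_lt (by nlinarith)
    have hadd := Submodule.finrank_add_finrank_orthogonal (Φ V)
    rw [finrank_euclideanSpace_fin] at hadd
    have hne : (Φ V)ᗮ ≠ ⊥ := by
      intro h
      rw [h, finrank_bot] at hadd
      omega
    obtain ⟨z, hz, hz0⟩ := Submodule.exists_mem_ne_zero_of_ne_bot hne
    set z' : E S := ‖z‖⁻¹ • z with hz'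
    have himg : ∀ k ≤ n, Function.update v n z' '' Set.Iio k = v '' Set.Iio k := by
      intro k hk
      refine Set.image_congr fun j hj => Function.update_of_ne ?_ _ _
      exact (lt_of_lt_of_le (Set.mem_Iio.1 hj) hk).ne
    refine ⟨Function.update v n z', fun k hk => ?_, fun k hk => ?_⟩
    · rcases eq_or_lt_of_le (Nat.lt_succ_iff.1 hk) with rfl | hlt
      · rw [himg k le_rfl, Function.update_self]
        exact ⟨norm_smul_inv_norm (𝕜 := ℝ) hz0, Submodule.smul_mem _ _ hz⟩
      · rw [himg k hlt.le, Function.update_of_ne hlt.ne]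
        exact hv k hlt
    · rw [Function.update_of_ne (by omega)]
      exact hv0 k (by omega)

/-- For every finite family of operators on a space of large dimension there is a frame such that,
within `T` rounds, no direction of the frame can be discovered by the operators alone. -/
theorem exists_hidden_frame {S N T : ℕ} {κ : Type*} [Fintype κ] (ops : κ → E S →ₗ[ℝ] E S)
    (hS : (1 + Fintype.card κ) ^ T * (N + 1) < S) :
    ∃ (e : E S) (u : ℕ → E S), IsFrame e u N ∧ ∀ k j, k ≤ j →
      ∀ x ∈ (enlarge ops)^[T] (Submodule.span ℝ (insert e (u '' Set.Iio k))),
        inner ℝ (u j) x = 0 := by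
  -- The first of the `N + 1` vectors serves as `e`, the others as the chain directions.
  obtain ⟨v, hv, hv0⟩ := exists_orthogonal_sequence (fun V => (enlarge ops)^[T] V)
    (fun V => finrank_iterate_enlarge_le ops V T) (N + 1) hS
  have hspan : ∀ k, insert (v 0) ((fun k => v (k + 1)) '' Set.Iio k) = v '' Set.Iio (k + 1) := by
    intro k
    ext x
    constructor
    · rintro (rfl | ⟨j, hj, rfl⟩)
      · exact ⟨0, Nat.succ_pos k, rfl⟩
      · exact ⟨j + 1, Nat.succ_lt_succ hj, rfl⟩
    · rintro ⟨j, hj, rfl⟩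
      cases j with
      | zero => exact Or.inl rfl
      | succ j => exact Or.inr ⟨j, Nat.lt_of_succ_lt_succ hj, rfl⟩
  have hhid : ∀ k j, k ≤ j → ∀ x ∈ (enlarge ops)^[T] (Submodule.span ℝ (v '' Set.Iio k)),
      inner ℝ (v j) x = 0 := by
    intro k j hkj x hx
    rcases lt_or_ge j (N + 1) with hj | hj
    · rw [real_inner_comm]
      refine (Submodule.mem_orthogonal _ _).1 (hv j hj).2 x ?_
      exact iterate_enlarge_mono ops
        (Submodule.span_mono (Set.image_mono (Set.Iio_subset_Iio hkj))) T hx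
    · rw [hv0 j hj, inner_zero_left]
  have hlt : ∀ i j, i < j → inner ℝ (v j) (v i) = 0 := fun i j hij =>
    hhid j j le_rfl _ (iterate_enlarge_le ops _ (Nat.zero_le T)
      (Submodule.subset_span ⟨i, hij, rfl⟩))
  refine ⟨v 0, fun k => v (k + 1), ⟨(hv 0 (Nat.succ_pos N)).1, fun k => ?_, fun j k => ?_⟩, ?_⟩
  · rw [real_inner_comm]
    exact hlt 0 (k + 1) (Nat.succ_pos k)
  · rcases lt_trichotomy j k with h | rfl | h
    · rw [real_inner_comm, hlt _ _ (Nat.succ_lt_succ h), if_neg (fun h' => h.ne h'.1)]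
    · by_cases hj : j < N
      · rw [real_inner_self_eq_norm_sq, (hv (j + 1) (Nat.succ_lt_succ hj)).1]
        simp [hj]
      · rw [hv0 (j + 1) (by omega), inner_zero_left]
        simp [hj]
    · rw [hlt _ _ (Nat.succ_lt_succ h), if_neg (fun h' => h.ne' h'.1)]
  · intro k j hkj x hx
    rw [hspan] at hx
    exact hhid (k + 1) (j + 1) (Nat.succ_le_succ hkj) x hx

end Reach

/-! ### Propagation of information along the path. -/

section Runs

variable {M : ℕ}

/-- The operator by which iterate `k` of node `j` enters iterate `t + 1` of its neighbour `i`. -/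
def Algorithm.messageOp (alg : Algorithm M) (S t k : ℕ) (i j : Fin M) : Op S :=
  match alg with
  | .classA Q Wv _ _ => Wv S t k i j ∘ₗ Q S k j
  | .classAPrime Q Wv _ _ => Wv S t k i ∘ₗ Q S k j

/-- The operator by which the gradient at iterate `k` enters iterate `t + 1`. -/
def Algorithm.gradientOp (alg : Algorithm M) (S t k : ℕ) (i : Fin M) : Op S :=
  match alg with
  | .classA _ _ Wg _ => Wg S t k i
  | .classAPrime _ _ Wg _ => Wg S t k i

/-- The operator by which a node's own iterate `k` enters its iterate `t + 1`. -/
def Algorithm.iterateOp (alg : Algorithm M) (S t k : ℕ) (i : Fin M) : Op S :=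
  match alg with
  | .classA _ _ _ Wx => Wx S t k i
  | .classAPrime _ _ _ Wx => Wx S t k i

/-- The operators used in the first `T` rounds. -/
def Algorithm.ops (alg : Algorithm M) (S T : ℕ) :
    Fin T × Fin T × Fin M × Fin M × Fin 3 → Op S
  | (t, k, i, j, 0) => alg.messageOp S t k i j
  | (t, k, i, _, 1) => alg.gradientOp S t k i
  | (t, k, i, _, 2) => alg.iterateOp S t k i

/-- Treats both classes at once: by linearity, a block applied to the sum of messages is a sum of
images of individual messages. -/
theorem Algorithm.admissible_le (alg : Algorithm M) (G : SimpleGraph (Fin M)) [DecidableRel G.Adj]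
    {S : ℕ} (f : Fin M → E S → ℝ) (x : ℕ → Fin M → E S) (t : ℕ) (i : Fin M)
    {V : Submodule ℝ (E S)}
    (hm : ∀ k ≤ t, ∀ j, G.Adj i j → alg.messageOp S t k i j (x k j) ∈ V)
    (hg : ∀ k ≤ t, alg.gradientOp S t k i (gradient (f i) (x k i)) ∈ V)
    (hx : ∀ k ≤ t, alg.iterateOp S t k i (x k i) ∈ V) : alg.admissible G f x t i ≤ V := by
  cases alg with
  | classA Q Wv Wg Wx =>
    refine Submodule.span_le.2 ?_
    rintro w ((⟨k, hk, j, hj, rfl⟩ | ⟨k, hk, rfl⟩) | ⟨k, hk, rfl⟩)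
    · exact hm k hk j hj
    · exact hg k hk
    · exact hx k hk
  | classAPrime Q Wv Wg Wx =>
    refine Submodule.span_le.2 ?_
    rintro w ((⟨k, hk, rfl⟩ | ⟨k, hk, rfl⟩) | ⟨k, hk, rfl⟩)
    · rw [map_sum]
      exact V.sum_mem fun j hj => hm k hk j ((G.mem_neighborFinset i j).1 hj)
    · exact hg k hk
    · exact hx k hk

/-- The distance of node `i` from the end of the path at which link `k` of the chain is held. -/
def distFromEnd (k : ℕ) (i : Fin M) : ℕ := if Even k then i else M - 1 - i

/-- The weight of link `k` of the chain at node `i`: even links are held by the first third of the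
path, odd links by the last third. -/
def linkWeight (N : ℕ) (i : Fin M) (k : ℕ) : ℝ :=
  if k < N ∧ 3 * distFromEnd k i < M then 1 else 0

theorem linkWeight_nonneg (N : ℕ) (i : Fin M) (k : ℕ) : 0 ≤ linkWeight N i k := by
  unfold linkWeight; split_ifs <;> norm_num

theorem linkWeight_le (N : ℕ) (i : Fin M) (k : ℕ) : linkWeight N i k ≤ 1 := by
  unfold linkWeight; split_ifs <;> norm_num

theorem linkWeight_self (N : ℕ) (i : Fin M) : linkWeight N i N = 0 := by simp [linkWeight]

theorem le_sum_linkWeight {N k : ℕ} (hk : k < N) : (M : ℝ) / 3 ≤ ∑ i : Fin M, linkWeight N i k := by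
  have hcard : M ≤ 3 * (Finset.univ.filter fun i : Fin M => 3 * (i : ℕ) < M).card := by
    rw [← Finset.card_map Fin.valEmbedding]
    have hsub : Finset.range ((M + 2) / 3) ⊆
        (Finset.univ.filter fun i : Fin M => 3 * (i : ℕ) < M).map Fin.valEmbedding := by
      intro j hj
      rw [Finset.mem_range] at hj
      rw [Finset.mem_map]
      exact ⟨⟨j, by omega⟩, by simp only [Finset.mem_filter_univ]; omega, rfl⟩
    have := Finset.card_le_card hsub
    rw [Finset.card_range] at this
    omega
  have hsum : ∑ i : Fin M, linkWeight N i k = ∑ i : Fin M, if 3 * (i : ℕ) < M then (1 : ℝ) else 0 := by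
    by_cases he : Even k
    · simp [linkWeight, hk, distFromEnd, he]
    -- Reversing the path exchanges the two ends and reduces odd links to even ones.
    · rw [← Equiv.sum_comp Fin.revPerm]
      refine Finset.sum_congr rfl fun i _ => ?_
      have h : M - 1 - ((Fin.revPerm i : Fin M) : ℕ) = i := by
        simp only [Fin.revPerm_apply, Fin.val_rev]
        omega
      simp only [linkWeight, hk, distFromEnd, he, if_false, true_and, h]
  rw [hsum, Finset.sum_boole]
  have : (M : ℝ) ≤ 3 * ((Finset.univ.filter fun i : Fin M => 3 * (i : ℕ) < M).card : ℝ) := by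
    exact_mod_cast hcard
  linarith

/-- Direction `k` of the chain reaches node `i` of the path at a time proportional to `k * M`. -/
theorem Algorithm.IsRun.mem_reach {alg : Algorithm M} {S N T : ℕ} {e : E S} {u : ℕ → E S}
    {U σ a : ℝ} (hσ : 0 < σ)
    (hhid : ∀ k j, k ≤ j → ∀ x ∈ (enlarge (alg.ops S T))^[T]
      (Submodule.span ℝ (insert e (u '' Set.Iio k))), inner ℝ (u j) x = 0)
    {x : ℕ → Fin M → E S}
    (hx : alg.IsRun (SimpleGraph.pathGraph M)
      (fun i => component e u N U σ a (linkWeight N i)) x) :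
    ∀ t ≤ T, ∀ (k : ℕ) (i : Fin M), 3 * t + M < k * M + 3 * distFromEnd k i →
      x t i ∈ (enlarge (alg.ops S T))^[t] (Submodule.span ℝ (insert e (u '' Set.Iio k))) := by
  intro t
  induction t using Nat.strong_induction_on with
  | _ t ih =>
    intro htT k i hk
    cases t with
    | zero => rw [hx.zero]; exact Submodule.zero_mem _
    | succ t =>
      have hiM := i.2
      have hop : ∀ (k' : ℕ), k' ≤ t → ∀ (j : Fin M) (c : Fin 3) (z : E S),
          z ∈ (enlarge (alg.ops S T))^[t] (Submodule.span ℝ (insert e (u '' Set.Iio k))) →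
          ∀ (ht : t < T) (hk' : k' < T), alg.ops S T (⟨t, ht⟩, ⟨k', hk'⟩, i, j, c) z ∈
            (enlarge (alg.ops S T))^[t + 1] (Submodule.span ℝ (insert e (u '' Set.Iio k))) := by
        intro k' hk' j c z hz ht hk'T
        rw [Function.iterate_succ_apply']
        exact apply_mem_enlarge _ hz _
      -- One round moves information by at most one edge: a decrease of the distance by 1 is paid
      -- for by the 3 gained in `3 * t`.
      have hmem : ∀ k' ≤ t, ∀ j : Fin M, distFromEnd k i ≤ distFromEnd k j + 1 →
          x k' j ∈ (enlarge (alg.ops S T))^[t] (Submodule.span ℝ (insert e (u '' Set.Iio k))) := by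
        intro k' hk' j hj
        exact iterate_enlarge_le _ _ hk' (ih k' (by omega) (by omega) k j (by omega))
      refine Algorithm.admissible_le alg _ _ x t i ?_ ?_ ?_ (hx.step t i)
      · intro k' hk' j hj
        have hd : distFromEnd k i ≤ distFromEnd k j + 1 := by
          rw [SimpleGraph.pathGraph_adj] at hj
          unfold distFromEnd
          split_ifs <;> omega
        exact hop k' hk' j 0 _ (hmem k' hk' j hd) (by omega) (by omega)
      · intro k' hk'
        refine hop k' hk' i 1 _ ?_ (by omega) (by omega)
        refine iterate_enlarge_le _ _ (Nat.zero_le t) ?_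
        refine gradient_component_mem hσ (linkWeight_self N i)
          (Submodule.subset_span (Set.mem_insert _ _))
          (fun j hj => Submodule.subset_span
            (Set.mem_insert_of_mem _ (Set.mem_image_of_mem u (Set.mem_Iio.2 hj))))
          (k := k) (fun j hj => ?_) ?_
        · exact hhid k j hj _ (iterate_enlarge_le _ _ (by omega) (hmem k' hk' i (by omega)))
        · by_cases hw : 3 * distFromEnd k i < M
          · right
            cases k with
            | zero => omega
            | succ k =>
              -- A node holding link `k + 1` is within a third of one end, hence far from the end
              -- holding link `k`. The induction hypothesis for the previous link therefore applies
              -- and shows that direction `k` has not arrived, so link `k + 1` is inactive.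
              have hd : distFromEnd (k + 1) i + distFromEnd k i = M - 1 := by
                simp only [distFromEnd, Nat.even_add_one]
                split_ifs <;> omega
              refine ⟨k, rfl, hhid k k le_rfl _ (iterate_enlarge_le _ _ (by omega : k' ≤ T)
                (ih k' (by omega) (by omega) k i ?_))⟩
              have hmul := Nat.succ_mul k M
              rw [Nat.succ_eq_add_one] at hmul
              omega
          · left
            simp [linkWeight, hw]
      · intro k' hk'
        exact hop k' hk' i 2 _ (hmem k' hk' i (by omega)) (by omega) (by omega)

end Runs

/-! ### From hidden directions to the iteration bound. -/

section LowerBound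

variable {M S : ℕ}

/-- The scalar Poincaré inequality summed over the coordinates of the centred variables; centring
does not affect edge differences. -/
theorem sum_norm_sub_mean_sq_le (hM : 2 ≤ M) (x : Fin M → E S) :
    secondSmallestEigenvalue hM (scaledLaplacian_isHermitian (SimpleGraph.pathGraph M)) *
        ∑ i, ‖x i - (1 / (M : ℝ)) • ∑ j, x j‖ ^ 2 ≤
      ∑ i, ∑ j with (SimpleGraph.pathGraph M).Adj i j ∧ i < j, ‖x i - x j‖ ^ 2 := by
  have hM0 : (0 : ℝ) < M := by exact_mod_cast (by omega : 0 < M)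
  have hc : ∀ s : Fin S, ∑ i, (x i s - (1 / (M : ℝ)) * ∑ j, x j s) = 0 := by
    intro s
    simp only [Finset.sum_sub_distrib, Finset.sum_const, Finset.card_univ, Fintype.card_fin,
      nsmul_eq_mul]
    field_simp
    ring
  have h1 : ∑ i, ‖x i - (1 / (M : ℝ)) • ∑ j, x j‖ ^ 2 =
      ∑ s : Fin S, ∑ i, (x i s - (1 / (M : ℝ)) * ∑ j, x j s) ^ 2 := by
    rw [Finset.sum_comm]
    refine Finset.sum_congr rfl fun i _ => ?_
    rw [EuclideanSpace.real_norm_sq_eq]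
    simp
  have h2 : ∑ i, ∑ j with (SimpleGraph.pathGraph M).Adj i j ∧ i < j, ‖x i - x j‖ ^ 2 =
      ∑ s : Fin S, dirichlet (SimpleGraph.pathGraph M)
        fun i => x i s - (1 / (M : ℝ)) * ∑ j, x j s := by
    unfold dirichlet
    rw [Finset.sum_comm]
    refine Finset.sum_congr rfl fun i _ => ?_
    rw [Finset.sum_comm]
    refine Finset.sum_congr rfl fun j _ => ?_
    rw [EuclideanSpace.real_norm_sq_eq]
    simp
  rw [h1, h2, Finset.mul_sum]
  exact Finset.sum_le_sum fun s _ => poincare_pathGraph hM (hc s)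

/-- The local error controls the gradient of the average function at the mean of the local
variables. -/
theorem norm_average_gradient_mean_sq_le (hM : 2 ≤ M) {U : ℝ} (hU0 : 0 < U) (hU1 : U ≤ 1)
    {f : Fin M → E S → ℝ}
    (hf : ∀ i x z, ‖gradient (f i) x - gradient (f i) z‖ ≤ U * ‖x - z‖) (x : Fin M → E S) :
    ‖(1 / (M : ℝ)) • ∑ i, gradient (f i) ((1 / (M : ℝ)) • ∑ j, x j)‖ ^ 2 ≤
      2 * localError hM (SimpleGraph.pathGraph M) U f x := by
  have hM0 : (0 : ℝ) < M := by exact_mod_cast (by omega : 0 < M)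
  set m : E S := (1 / (M : ℝ)) • ∑ j, x j with hm
  set p : E S := (1 / (M : ℝ)) • ∑ i, gradient (f i) (x i) with hp
  set D : ℝ := ∑ i, ‖x i - m‖ ^ 2 with hD
  have hD0 : 0 ≤ D := Finset.sum_nonneg fun _ _ => sq_nonneg _
  have hdiff : ‖(1 / (M : ℝ)) • ∑ i, gradient (f i) m - p‖ ^ 2 ≤ U ^ 2 / M * D := by
    have h1 : ‖(1 / (M : ℝ)) • ∑ i, gradient (f i) m - p‖ ≤ 1 / M * (U * ∑ i, ‖x i - m‖) := by
      rw [hp, ← smul_sub, ← Finset.sum_sub_distrib, norm_smul, Real.norm_of_nonneg (by positivity),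
        Finset.mul_sum]
      refine mul_le_mul_of_nonneg_left ((norm_sum_le _ _).trans ?_) (by positivity)
      refine Finset.sum_le_sum fun i _ => ?_
      rw [norm_sub_rev (x i)]
      exact hf i m (x i)
    refine (pow_le_pow_left₀ (norm_nonneg _) h1 2).trans ?_
    have h2 : (∑ i, ‖x i - m‖) ^ 2 ≤ M * D := by
      simpa using sq_sum_le_card_mul_sum_sq (s := Finset.univ) (f := fun i => ‖x i - m‖)
    calc (1 / M * (U * ∑ i, ‖x i - m‖)) ^ 2 = U ^ 2 / M ^ 2 * (∑ i, ‖x i - m‖) ^ 2 := by ring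
      _ ≤ U ^ 2 / M ^ 2 * (M * D) := mul_le_mul_of_nonneg_left h2 (by positivity)
      _ = U ^ 2 / M * D := by field_simp
  have hlam := secondSmallest_scaledLaplacian_pos hM
  have hpoin := sum_norm_sub_mean_sq_le hM x
  set lam := secondSmallestEigenvalue hM (scaledLaplacian_isHermitian (SimpleGraph.pathGraph M))
    with hlamdef
  have hcons : U ^ 2 / M * D ≤ U / (M * lam) *
      ∑ i, ∑ j with (SimpleGraph.pathGraph M).Adj i j ∧ i < j, ‖x i - x j‖ ^ 2 := by
    -- Here `U ≤ 1` is needed: the accuracy measure weights disagreement by `U`, whereas the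
    -- Lipschitz bound produces `U ^ 2`.
    calc U ^ 2 / M * D ≤ U / M * D := by
          refine mul_le_mul_of_nonneg_right ?_ hD0
          gcongr
          nlinarith
      _ = U / (M * lam) * (lam * D) := by field_simp
      _ ≤ _ := mul_le_mul_of_nonneg_left hpoin (by positivity)
  have htri : ‖(1 / (M : ℝ)) • ∑ i, gradient (f i) m‖ ≤
      ‖p‖ + ‖(1 / (M : ℝ)) • ∑ i, gradient (f i) m - p‖ := norm_le_insert' _ _
  have hsq := pow_le_pow_left₀ (norm_nonneg _) htri 2
  unfold localError
  nlinarith [sq_nonneg (‖p‖ - ‖(1 / (M : ℝ)) • ∑ i, gradient (f i) m - p‖)]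

/-- On the hard family the local error stays large until the last direction of the chain has
been reached. -/
theorem le_localError_component (hM : 2 ≤ M) {e : E S} {u : ℕ → E S} {N : ℕ} {U σ a ε : ℝ}
    (h : IsFrame e u N) (hU0 : 0 < U) (hU1 : U ≤ 1) (hσ : 0 < σ) (hN : 0 < N)
    (hσε : U ^ 2 * σ ^ 2 = 3528 * ε) {x : Fin M → E S}
    (hx : ∀ i, inner ℝ (u (N - 1)) (x i) = 0) :
    ε ≤ localError hM (SimpleGraph.pathGraph M) U
      (fun i => component e u N U σ a (linkWeight N i)) x := by
  have h1 := norm_average_gradient_mean_sq_le hM hU0 hU1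
    (f := fun i => component e u N U σ a (linkWeight N i))
    (fun i => norm_gradient_component_sub_le h hU0 hσ (linkWeight_nonneg N i) (linkWeight_le N i)
      (linkWeight_self N i)) x
  have h2 := le_norm_average_gradient_component (a := a) (by omega : 0 < M) h hU0 hσ hN
    (linkWeight_nonneg N) (linkWeight_self N) (fun k hk => le_sum_linkWeight hk)
    (x := (1 / (M : ℝ)) • ∑ j, x j) (by simp [inner_smul_right, inner_sum, hx])
  have h3 := pow_le_pow_left₀ (by positivity) h2 2
  -- The scale satisfies 3528 = 2 · 42², the factor 2 making up for the loss in passing to the mean.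
  have h4 : (U * σ / 42) ^ 2 = 2 * ε := by
    rw [div_pow, mul_pow, hσε]; ring
  rw [h4] at h3
  linarith [h3.trans h1]

/-- For every algorithm there is a hard problem on which the number of iterations is proportional
to the number of nodes times the number of links of the chain. -/
theorem exists_hard_family (hM : 2 ≤ M) {U : ℝ} (hU0 : 0 < U) (hU1 : U ≤ 1) {ε : ℝ} (hε : 0 < ε)
    {Δ : ℝ} (alg : Algorithm M) {L : ℕ} (hLle : L * ε * 14850 ≤ Δ * U) :
    ∃ (S : ℕ) (f : Fin M → E S → ℝ), ProblemClass U f ∧ initialGap U f = Δ ∧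
      ∀ x : ℕ → Fin M → E S, alg.IsRun (SimpleGraph.pathGraph M) f x →
        ∀ t : ℕ, hStar hM (SimpleGraph.pathGraph M) U f x t < ε → 2 * M * L ≤ 3 * t := by
  -- The last direction is hidden from all nodes while `3 * t < (N - 2) * M`; for `L ≥ 1` and `N = 4
  -- * L` this includes every `t` with `3 * t < 2 * M * L`.
  set N : ℕ := 4 * L with hN
  set T : ℕ := N * M with hT
  set S : ℕ := (1 + Fintype.card (Fin T × Fin T × Fin M × Fin M × Fin 3)) ^ T * (N + 1) + 1 with hS
  obtain ⟨e, u, hframe, hhid⟩ := exists_hidden_frame (N := N) (T := T) (alg.ops S T)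
    (Nat.lt_succ_self _)
  set σ : ℝ := √(3528 * ε) / U with hσdef
  have hσ : 0 < σ := by positivity
  have hσε : U ^ 2 * σ ^ 2 = 3528 * ε := by
    rw [hσdef, div_pow, Real.sq_sqrt (by positivity)]
    field_simp
  set g : ℝ := initialGap U fun i : Fin M => component e u N U σ 0 (linkWeight N i) with hg
  have hgΔ : g ≤ Δ := by
    have h1 : g ≤ U * σ ^ 2 * N / 6 := initialGap_component_le (by omega) hframe hU0 hσ
      (linkWeight_nonneg N) (linkWeight_le N) (linkWeight_self N)
    refine h1.trans (le_of_mul_le_mul_right ?_ hU0)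
    have h2 : U * σ ^ 2 * N / 6 * U = U ^ 2 * σ ^ 2 * N / 6 := by ring
    rw [h2, hσε, hN]
    push_cast
    have : 0 ≤ (L : ℝ) * ε := by positivity
    linarith
  -- Solves `g + 3 / 2 * U * a ^ 2 = Δ`, which is possible because the gap without offset does not
  -- exceed `Δ`.
  set a : ℝ := √((Δ - g) / (3 / 2 * U)) with ha
  have hgap : initialGap U (fun i : Fin M => component e u N U σ a (linkWeight N i)) = Δ := by
    rw [initialGap_component (by omega) hframe hU0 hσ (linkWeight_self N), ← hg, ha,
      Real.sq_sqrt (div_nonneg (sub_nonneg.2 hgΔ) (by positivity))]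
    field_simp
    ring
  refine ⟨S, fun i => component e u N U σ a (linkWeight N i),
    problemClass_component (by omega) hframe hU0 hσ (linkWeight_nonneg N) (linkWeight_le N)
      (linkWeight_self N), hgap, fun x hx t ht => ?_⟩
  -- For `L = 0` the chain is empty and has no last direction, but the claimed bound is trivial.
  rcases Nat.eq_zero_or_pos L with hL0 | hLpos
  · rw [hL0, mul_zero]; exact Nat.zero_le _
  obtain ⟨s, hs, hse⟩ := (Finset.inf'_lt_iff _).1 ht
  rw [Finset.mem_range] at hs
  by_contra! hlt
  have hLM : M * 1 ≤ M * L := Nat.mul_le_mul_left M hLpos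
  have hNM : T = 4 * (M * L) := by rw [hT, hN]; ring
  refine absurd hse (not_lt.2 (le_localError_component hM hframe hU0 hU1 hσ (by omega) hσε
    fun i => ?_))
  have hsT : s ≤ T := by nlinarith
  refine hhid (N - 1) (N - 1) le_rfl _ (iterate_enlarge_le _ _ hsT
    (hx.mem_reach hσ hhid s hsT (N - 1) i ?_))
  have h1 : (N - 1) * M = 4 * (M * L) - M := by
    rw [Nat.sub_mul, one_mul, ← hNM]
  have h2 : 2 * M * L = 2 * (M * L) := by ring
  omega

end LowerBound

end DistOpt

/-- Lower complexity bound over the path graph on `M` vertices. For every prescribed value `Δ` of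
`f(0) - inf f + ‖d₀‖² / (M U)` there is a problem in the class on which the algorithm
needs the stated number of iterations. -/
theorem theorem3p1 (M : ℕ) (hM : 2 ≤ M) (U : ℝ) (hU0 : 0 < U) (hU1 : U < 1)
    (ε : ℝ) (hε : 0 < ε) (Δ : ℝ) (hΔ : 0 < Δ) (alg : DistOpt.Algorithm M) :
    ∃ (S : ℕ) (f : Fin M → DistOpt.E S → ℝ),
      DistOpt.ProblemClass U f ∧
      DistOpt.initialGap U f = Δ ∧
      ∀ x : ℕ → Fin M → DistOpt.E S, alg.IsRun (SimpleGraph.pathGraph M) f x →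
        ∀ t : ℕ, DistOpt.hStar hM (SimpleGraph.pathGraph M) U f x t < ε →
          1 / (3 * √(DistOpt.spectralGap hM (SimpleGraph.pathGraph M))) *
              (⌊DistOpt.initialGap U f * U / (1650 * Real.pi ^ 2) * ε⁻¹⌋ : ℝ) ≤ (t : ℝ) := by
  have hM0 : (0 : ℝ) < M := by exact_mod_cast (by omega : 0 < M)
  set L : ℕ := ⌊Δ * U / (1650 * Real.pi ^ 2) * ε⁻¹⌋.toNat with hL
  have hfloor0 : 0 ≤ ⌊Δ * U / (1650 * Real.pi ^ 2) * ε⁻¹⌋ := Int.floor_nonneg.2 (by positivity)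
  have hLcast : (⌊Δ * U / (1650 * Real.pi ^ 2) * ε⁻¹⌋ : ℝ) = L := by
    exact_mod_cast (Int.toNat_of_nonneg hfloor0).symm
  -- `π > 3` gives 14850 = 1650 · 9, well above the `3528 * 4 / 6 = 2352` needed for the gap of the
  -- chain.
  have hLle : (L : ℝ) * ε * 14850 ≤ Δ * U := by
    have h1 : (L : ℝ) ≤ Δ * U / (1650 * Real.pi ^ 2) * ε⁻¹ := hLcast ▸ Int.floor_le _
    have h2 : Δ * U / (1650 * Real.pi ^ 2) * ε⁻¹ ≤ Δ * U / (1650 * 3 ^ 2) * ε⁻¹ := by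
      have := Real.pi_gt_three.le
      gcongr
    have h3 := h1.trans h2
    rw [← div_eq_mul_inv, le_div_iff₀ hε, le_div_iff₀ (by norm_num)] at h3
    linarith
  obtain ⟨S, f, hf, hgap, hrun⟩ := DistOpt.exists_hard_family hM hU0 hU1.le hε alg hLle
  refine ⟨S, f, hf, hgap, fun x hx t ht => ?_⟩
  rw [hgap, hLcast]
  have hcoef : 1 / (3 * √(DistOpt.spectralGap hM (SimpleGraph.pathGraph M))) ≤ 2 * M / 3 := by
    have h1 := DistOpt.inv_le_sqrt_spectralGap_pathGraph hM
    rw [div_le_iff₀ (by positivity)] at h1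
    have h2 : 0 < √(DistOpt.spectralGap hM (SimpleGraph.pathGraph M)) :=
      lt_of_le_of_ne (Real.sqrt_nonneg _) fun h0 => by rw [← h0] at h1; norm_num at h1
    rw [div_le_div_iff₀ (by positivity) (by norm_num)]
    linarith
  refine (mul_le_mul_of_nonneg_right hcoef (Nat.cast_nonneg L)).trans ?_
  have h : (2 : ℝ) * M * L ≤ 3 * t := by exact_mod_cast hrun x hx t ht
  linarith
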